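/- Let $G$ be a second countable locally compact Hausdorff groupoid with unit space $G^{(0)}$, range and source maps $r,s$ and a Haar system $\{\lambda^u\}_{u\in G^{(0)}}$. Let $(A,\alpha)$ be a $G$-dynamical system: $A=\Gamma_0(G^{(0)},\mathscr A)$ is the (separable) section algebra of an upper semicontinuous $C^*$-bundle $\mathscr A$ over $G^{(0)}$ with fibres $A(u)$, and the $\alpha_\gamma:A(s(\gamma))\to A(r(\gamma))$ are $*$-isomorphisms with $\alpha_\gamma\alpha_\eta=\alpha_{\gamma\eta}$ for composable $\gamma,\eta$ such that $(\gamma,z)\mapsto\alpha_\gamma(z)$ is continuous. A continuous section $f$ of $r^*\mathscr A$ is called integrable if it lies in the completion of $\Gamma_c(G,r^*\mathscr A)$ for the norm $$\|f\|_I=\max\Big\{\sup_u\int\|f(\gamma)\|\,d\lambda^u(\gamma),\ \sup_u\int\|f(\gamma^{-1})\|\,d\lambda^u(\gamma)\Big\},$$ i.e. for every $\varepsilon>0$ there is $g\in\Gamma_c(G,r^*\mathscr A)$ with $\|f-g\|_I<\varepsilon$. Suppose that $(A,\alpha)$ is proper with respect to a dense $*$-subalgebra $A_0\subseteq A$, that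 is, for all $a,b\in A_0$: 1. the function ${}_E\langle a,b\rangle:\gamma\mapsto a(r(\gamma))\,\alpha_\gamma(b(s(\gamma))^*)$ is integrable; 2. there is a unique $\langle a,b\rangle_D\in M(A_0)^\alpha:=\{d\in M(A): A_0d\subseteq A_0,\ \bar\alpha_\gamma(d(s(\gamma)))=d(r(\gamma))\ \forall\gamma\in G\}$ such that $(c\,\langle a,b\rangle_D)(u)=\int_G c(r(\gamma))\,\alpha_\gamma\big((a^*b)(s(\gamma))\big)\,d\lambda^u(\gamma)$ for all $c\in A_0$ and $u\in G^{(0)}$. Let $C$ be a $*$-subalgebra of $C_c(G)$ (for convolution and $f^*(\gamma)=\overline{f(\gamma^{-1})}$) that is dense in the inductive limit topology, and suppose that $C\cdot A_0\subseteq A_0$, where $$(f\cdot a)(u)=\int_G f(\gamma)\,\alpha_\gamma(a(s(\gamma)))\,d\lambda^u(\gamma)\qquad(f\in C_c(G),\ a\in A).$$ Let $A\rtimes_{\alpha,r}G$ be the reduced crossed product, i.e. the completion of $\Gamma_c(G,r^*\mathscr A)$ in the norm given by the regular representations; concretely, for any faithful representations $\pi_u$ of the fibres $A(u)$ on Hilbert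 spaces $H_u$, it is the $C^*$-algebra generated by the operators $\Lambda(f)$, $f\in\Gamma_c(G,r^*\mathscr A)$, on $\bigoplus_u L^2(G_u,\lambda_u;H_u)$, where $G_u=s^{-1}(u)$, $\lambda_u$ is the image of $\lambda^u$ under inversion, and $$(\Lambda(f)\xi)(\gamma)=\int_G \pi_u\big(\alpha_\gamma^{-1}(f(\eta))\big)\,\xi(\eta^{-1}\gamma)\,d\lambda^{r(\gamma)}(\eta)\qquad(\gamma\in G_u).$$ Then $\Lambda(f)$ is a well-defined bounded operator for every $f\in\Gamma_c(G,r^*\mathscr A)$ and for every $f={}_E\langle a,b\rangle$ with $a,b\in A_0$; and $$E:=\overline{\operatorname{span}}\{{}_E\langle a,b\rangle: a,b\in A_0\}$$ (each ${}_E\langle a,b\rangle$ being identified with the operator $\Lambda({}_E\langle a,b\rangle)$) is contained in $A\rtimes_{\alpha,r}G$ and is a two-sided ideal of it. -/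

import Mathlib

open CategoryTheory MeasureTheory Topology Filter
open scoped ENNReal

noncomputable section

namespace GpdProper

universe uX vX wA wH

/-! ### Topological groupoids

The algebraic groupoid is Mathlib's `CategoryTheory.Groupoid X`, where `X` is the unit space.  An
arrow `γ : u ⟶ v` has source `s(γ) = u` and range `r(γ) = v`, and the groupoid product `γη`
(defined for `s(γ) = r(η)`) is the composite `η ≫ γ`. -/

/-- The set of all arrows of the groupoid (this is the groupoid `G` itself). -/
@[ext]
structure Arr (X : Type uX) [Quiver.{vX} X] where
  src : X
  tgt : X
  hom : src ⟶ tgt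

/-- The range fibre `G^u = r⁻¹(u)`. -/
@[ext]
structure RFib {X : Type uX} [Quiver.{vX} X] (u : X) where
  dom : X
  hom : dom ⟶ u

/-- The source fibre `G_u = s⁻¹(u)`. -/
@[ext]
structure SFib {X : Type uX} [Quiver.{vX} X] (u : X) where
  cod : X
  hom : u ⟶ cod

/-- The set `G⁽²⁾` of composable pairs `(γ, η)`, `s(γ) = r(η)`; here `fst` is `η`, `snd` is `γ`. -/
structure Comp (X : Type uX) [Quiver.{vX} X] where
  a : X
  b : X
  c : X
  fst : a ⟶ b
  snd : b ⟶ c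

/-- The inclusion `G^u ⊆ G`. -/
abbrev RFib.toArr {X : Type uX} [Quiver.{vX} X] {u : X} (γ : RFib u) : Arr X :=
  ⟨γ.dom, u, γ.hom⟩

/-- The inclusion `G_u ⊆ G`. -/
abbrev SFib.toArr {X : Type uX} [Quiver.{vX} X] {u : X} (γ : SFib u) : Arr X :=
  ⟨u, γ.cod, γ.hom⟩

/-- Inversion on `G`. -/
abbrev Arr.inv {X : Type uX} [Groupoid.{vX} X] (γ : Arr X) : Arr X :=
  ⟨γ.tgt, γ.src, Groupoid.inv γ.hom⟩

/-- Inversion as a map `G^u → G_u`. -/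
abbrev RFib.inv {X : Type uX} [Groupoid.{vX} X] {u : X} (γ : RFib u) : SFib u :=
  ⟨γ.dom, Groupoid.inv γ.hom⟩

section Top
variable {X : Type uX} [Quiver.{vX} X] [TopologicalSpace (Arr X)]

/-- `G^u` has the subspace topology. -/
instance RFib.instTop (u : X) : TopologicalSpace (RFib u) :=
  TopologicalSpace.induced RFib.toArr inferInstance

/-- `G_u` has the subspace topology. -/
instance SFib.instTop (u : X) : TopologicalSpace (SFib u) :=
  TopologicalSpace.induced SFib.toArr inferInstance

/-- `G⁽²⁾` has the subspace topology of `G × G`. -/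
instance Comp.instTop : TopologicalSpace (Comp X) :=
  TopologicalSpace.induced
    (fun p => ((⟨p.b, p.c, p.snd⟩ : Arr X), (⟨p.a, p.b, p.fst⟩ : Arr X))) inferInstance

instance RFib.instMeas (u : X) : MeasurableSpace (RFib u) := borel _
instance RFib.instBorel (u : X) : BorelSpace (RFib u) := ⟨rfl⟩
instance SFib.instMeas (u : X) : MeasurableSpace (SFib u) := borel _
instance SFib.instBorel (u : X) : BorelSpace (SFib u) := ⟨rfl⟩

end Top

/-- A topological groupoid: composition and inversion are continuous, range and source are
continuous, and so is `u ↦ id_u` (so the topology of `X` is that of the unit space inside `G`). -/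
class IsTopGroupoid (X : Type uX) [Groupoid.{vX} X] [TopologicalSpace X]
    [TopologicalSpace (Arr X)] : Prop where
  continuous_src : Continuous (fun γ : Arr X => γ.src)
  continuous_tgt : Continuous (fun γ : Arr X => γ.tgt)
  continuous_id : Continuous (fun u : X => (⟨u, u, 𝟙 u⟩ : Arr X))
  continuous_inv : Continuous (fun γ : Arr X => γ.inv)
  continuous_comp : Continuous (fun p : Comp X => (⟨p.a, p.c, p.fst ≫ p.snd⟩ : Arr X))

/-- `C_c(G)`. -/
abbrev Cc (X : Type uX) [Quiver.{vX} X] [TopologicalSpace (Arr X)] :=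
  CompactlySupportedContinuousMap (Arr X) ℂ

/-- A (left) Haar system `{λ^u}`; the measure `λ^u`, which is concentrated on `G^u`, is regarded as
a measure on `G^u`. -/
structure HaarSystem (X : Type uX) [Groupoid.{vX} X] [TopologicalSpace X]
    [TopologicalSpace (Arr X)] where
  /-- the measure `λ^u` -/
  meas : ∀ u : X, Measure (RFib u)
  finite_on_compacts : ∀ u, IsFiniteMeasureOnCompacts (meas u)
  /-- `supp λ^u = G^u` -/
  full_support : ∀ u, (meas u).IsOpenPosMeasure
  continuous_integral : ∀ f : Cc X, Continuous (fun u => ∫ γ : RFib u, f γ.toArr ∂(meas u))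
  left_invariant : ∀ {u v : X} (η : u ⟶ v) (f : Cc X),
    ∫ γ : RFib u, f ⟨γ.dom, v, γ.hom ≫ η⟩ ∂(meas u) = ∫ γ : RFib v, f γ.toArr ∂(meas v)

/-- The measure `λ_u` on `G_u`: the image of `λ^u` under inversion. -/
def HaarSystem.smeas {X : Type uX} [Groupoid.{vX} X] [TopologicalSpace X]
    [TopologicalSpace (Arr X)] (haar : HaarSystem X) (u : X) : Measure (SFib u) :=
  (haar.meas u).map RFib.inv

/-! ### Convolution on `C_c(G)` and the inductive limit topology -/

/-- `(f * g)(γ) = ∫ f(η) g(η⁻¹γ) dλ^{r(γ)}(η)`. -/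
def convCc {X : Type uX} [Groupoid.{vX} X] [TopologicalSpace X] [TopologicalSpace (Arr X)]
    (haar : HaarSystem X) (f g : Cc X) (γ : Arr X) : ℂ :=
  ∫ η : RFib γ.tgt, f η.toArr * g ⟨γ.src, η.dom, γ.hom ≫ Groupoid.inv η.hom⟩ ∂(haar.meas γ.tgt)

/-- The linear subspace `C` of `C_c(G)` is a `*`-subalgebra, for convolution and the involution
`f^*(γ) = conj f(γ⁻¹)`. -/
structure IsStarSubalgebraCc {X : Type uX} [Groupoid.{vX} X] [TopologicalSpace X]
    [TopologicalSpace (Arr X)] (haar : HaarSystem X) (C : Submodule ℂ (Cc X)) : Prop where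
  conv_mem : ∀ f ∈ C, ∀ g ∈ C, ∃ h ∈ C, ∀ γ, h γ = convCc haar f g γ
  star_mem : ∀ f ∈ C, ∃ h ∈ C, ∀ γ, h γ = star (f γ.inv)

/-- `C` is dense in `C_c(G)` for the inductive limit topology.  That topology is the locally convex
topology defined by all seminorms whose restriction to each of the spaces
`{f | supp f ⊆ K}`, `K` compact, is continuous for the supremum norm. -/
def IsIndLimDense {X : Type uX} [Quiver.{vX} X] [TopologicalSpace (Arr X)]
    (C : Submodule ℂ (Cc X)) : Prop :=
  ∀ p : Seminorm ℂ (Cc X),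
    (∀ K : Set (Arr X), IsCompact K → ∃ M : ℝ, ∀ f : Cc X, tsupport f ⊆ K →
      ∀ m : ℝ, (∀ γ, ‖f γ‖ ≤ m) → p f ≤ M * m) →
    ∀ f : Cc X, ∀ ε > 0, ∃ g ∈ C, p (f - g) < ε

/-! ### Upper semicontinuous C⋆-bundles and their sections -/

/-- The total space of a family of fibres `A u`. -/
@[ext]
structure Tot {X : Type uX} (A : X → Type wA) where
  base : X
  val : A base

/-- Pairs of points of the total space that lie over the same base point. -/
structure FibProd {X : Type uX} (A : X → Type wA) where
  base : X
  fst : A base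
  snd : A base

/-- The fibred product has the subspace topology. -/
instance FibProd.instTop {X : Type uX} (A : X → Type wA) [TopologicalSpace (Tot A)] :
    TopologicalSpace (FibProd A) :=
  TopologicalSpace.induced
    (fun p => ((⟨p.base, p.fst⟩ : Tot A), (⟨p.base, p.snd⟩ : Tot A))) inferInstance

/-- An upper semicontinuous C⋆-bundle over `X`. -/
class IsUSCStarBundle {X : Type uX} [TopologicalSpace X] (A : X → Type wA)
    [∀ u, NonUnitalCStarAlgebra (A u)] [TopologicalSpace (Tot A)] : Prop where
  continuous_proj : Continuous (fun z : Tot A => z.base)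
  isOpenMap_proj : IsOpenMap (fun z : Tot A => z.base)
  usc_norm : UpperSemicontinuous (fun z : Tot A => ‖z.val‖)
  continuous_add : Continuous (fun p : FibProd A => (⟨p.base, p.fst + p.snd⟩ : Tot A))
  continuous_smul : ∀ k : ℂ, Continuous (fun z : Tot A => (⟨z.base, k • z.val⟩ : Tot A))
  tendsto_zero : ∀ (l : Filter (Tot A)) (u : X), Tendsto (fun z : Tot A => ‖z.val‖) l (𝓝 0) →
    Tendsto (fun z : Tot A => z.base) l (𝓝 u) → l ≤ 𝓝 (⟨u, 0⟩ : Tot A)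
  continuous_mul : Continuous (fun p : FibProd A => (⟨p.base, p.fst * p.snd⟩ : Tot A))
  continuous_star : Continuous (fun z : Tot A => (⟨z.base, star z.val⟩ : Tot A))

section Bundle
variable {X : Type uX} [TopologicalSpace X] {A : X → Type wA}
  [∀ u, NonUnitalCStarAlgebra (A u)] [TopologicalSpace (Tot A)]

/-- `a` belongs to the section algebra `A = Γ_0(X, 𝒜)`. -/
structure IsC0Section (a : ∀ u, A u) : Prop where
  continuous : Continuous (fun u => (⟨u, a u⟩ : Tot A))
  vanish : ∀ ε > 0, IsCompact {u | ε ≤ ‖a u‖}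

/-- The set `B` of sections is dense in `Γ_0(X, 𝒜)` for the supremum norm. -/
def IsDenseInSections (B : Set (∀ u, A u)) : Prop :=
  (∀ b ∈ B, IsC0Section b) ∧
    ∀ a : ∀ u, A u, IsC0Section a → ∀ ε > 0, ∃ b ∈ B, ∀ u, ‖a u - b u‖ ≤ ε

variable (A) in
/-- The section algebra `Γ_0(X, 𝒜)` is separable. -/
def IsSeparableSections : Prop :=
  ∃ B : Set (∀ u, A u), B.Countable ∧ IsDenseInSections B

/-- `d = (d(u))_u`, a family of multipliers of the fibres, is an element of `M(A)`,
`A = Γ_0(X, 𝒜)`: for all sections `a ∈ A` both `d a` and `a d` are in `A`. -/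
def IsMultiplier (d : ∀ u, DoubleCentralizer ℂ (A u)) : Prop :=
  ∀ a : ∀ u, A u, IsC0Section a →
    IsC0Section (fun u => (d u).fst (a u)) ∧ IsC0Section (fun u => (d u).snd (a u))

end Bundle

/-! ### Groupoid dynamical systems -/

/-- The fibred product `G * 𝒜 = {(γ, z) : s(γ) = p(z)}`. -/
structure ActDom {X : Type uX} [Quiver.{vX} X] (A : X → Type wA) where
  src : X
  tgt : X
  hom : src ⟶ tgt
  val : A src

/-- `G * 𝒜` has the subspace topology of `G × 𝒜`. -/
instance ActDom.instTop {X : Type uX} [Quiver.{vX} X] (A : X → Type wA)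
    [TopologicalSpace (Arr X)] [TopologicalSpace (Tot A)] : TopologicalSpace (ActDom A) :=
  TopologicalSpace.induced
    (fun p => ((⟨p.src, p.tgt, p.hom⟩ : Arr X), (⟨p.src, p.val⟩ : Tot A))) inferInstance

/-- A continuous action `α` of the groupoid on the bundle by `*`-isomorphisms
`α_γ : A(s(γ)) → A(r(γ))`. -/
structure DynSys (X : Type uX) [Groupoid.{vX} X] [TopologicalSpace (Arr X)] (A : X → Type wA)
    [∀ u, NonUnitalCStarAlgebra (A u)] [TopologicalSpace (Tot A)] where
  /-- the isomorphisms `α_γ` -/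
  act : ∀ {u v : X}, (u ⟶ v) → (A u ≃⋆ₐ[ℂ] A v)
  act_comp : ∀ {u v w : X} (η : u ⟶ v) (γ : v ⟶ w) (x : A u),
    act γ (act η x) = act (η ≫ γ) x
  continuous_act : Continuous (fun p : ActDom A => (⟨p.tgt, act p.hom p.val⟩ : Tot A))

section Dyn
variable {X : Type uX} [Groupoid.{vX} X] [TopologicalSpace X] [TopologicalSpace (Arr X)]
  {A : X → Type wA} [∀ u, NonUnitalCStarAlgebra (A u)] [TopologicalSpace (Tot A)]

/-- `f ∈ Γ_c(G, r^*𝒜)`. -/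
structure IsCcSection (f : ∀ γ : Arr X, A γ.tgt) : Prop where
  continuous : Continuous (fun γ : Arr X => (⟨γ.tgt, f γ⟩ : Tot A))
  compact : IsCompact (closure {γ : Arr X | f γ ≠ 0})

/-- The norm `‖·‖_I`, with values in `[0, ∞]`. -/
def iNorm (haar : HaarSystem X) (f : ∀ γ : Arr X, A γ.tgt) : ℝ≥0∞ :=
  max (⨆ u : X, ∫⁻ γ : RFib u, ‖f γ.toArr‖ₑ ∂(haar.meas u))
    (⨆ u : X, ∫⁻ γ : RFib u, ‖f γ.toArr.inv‖ₑ ∂(haar.meas u))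

/-- `f` is integrable: it is a continuous section of `r^*𝒜` that lies in the completion of
`Γ_c(G, r^*𝒜)` for the norm `‖·‖_I` (the analogue of `L¹(G, A)`). -/
def IsIntegrableSection (haar : HaarSystem X) (f : ∀ γ : Arr X, A γ.tgt) : Prop :=
  Continuous (fun γ : Arr X => (⟨γ.tgt, f γ⟩ : Tot A)) ∧
    ∀ ε : ℝ≥0∞, 0 < ε → ∃ g : ∀ γ : Arr X, A γ.tgt, IsCcSection g ∧
      iNorm haar (fun γ => f γ - g γ) < ε

/-- `⟨a, b⟩_E : γ ↦ a(r(γ)) α_γ(b(s(γ))^*)`. -/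
def innerE (S : DynSys X A) (a b : ∀ u, A u) (γ : Arr X) : A γ.tgt :=
  a γ.tgt * S.act γ.hom (star (b γ.src))

/-- `d ∈ M(A_0)^α`: `d ∈ M(A)`, `A_0 d ⊆ A_0`, and `ᾱ_γ(d(s(γ))) = d(r(γ))` for all `γ`.  Here
`ᾱ_γ(m)`, for a multiplier `m` of `A(s(γ))`, is the multiplier of `A(r(γ))` with
`ᾱ_γ(m) α_γ(x) = α_γ(m x)` and `α_γ(x) ᾱ_γ(m) = α_γ(x m)`. -/
structure IsInvMultiplier (S : DynSys X A) (A₀ : Set (∀ u, A u))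
    (d : ∀ u, DoubleCentralizer ℂ (A u)) : Prop where
  isMultiplier : IsMultiplier d
  mul_mem : ∀ a ∈ A₀, (fun u => (d u).snd (a u)) ∈ A₀
  invariant_fst : ∀ {u v : X} (γ : u ⟶ v) (x : A u),
    (d v).fst (S.act γ x) = S.act γ ((d u).fst x)
  invariant_snd : ∀ {u v : X} (γ : u ⟶ v) (x : A u),
    (d v).snd (S.act γ x) = S.act γ ((d u).snd x)

/-- The dynamical system is proper with respect to the dense `*`-subalgebra `A₀` of
`A = Γ_0(X, 𝒜)`. -/
structure IsProper (haar : HaarSystem X) (S : DynSys X A)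
    (A₀ : NonUnitalStarSubalgebra ℂ (∀ u, A u)) : Prop where
  dense : IsDenseInSections (A₀ : Set (∀ u, A u))
  integrable : ∀ a ∈ A₀, ∀ b ∈ A₀, IsIntegrableSection haar (innerE S a b)
  exists_innerD : ∀ a ∈ A₀, ∀ b ∈ A₀, ∃! d : ∀ u, DoubleCentralizer ℂ (A u),
    IsInvMultiplier S (A₀ : Set (∀ u, A u)) d ∧
      ∀ c ∈ A₀, ∀ u, (d u).snd (c u) =
        ∫ γ : RFib u, c u * S.act γ.hom (star (a γ.dom) * b γ.dom) ∂(haar.meas u)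

/-- `(f · a)(u) = ∫ f(γ) α_γ(a(s(γ))) dλ^u(γ)` for `f ∈ C_c(G)`. -/
def ccAct (haar : HaarSystem X) (S : DynSys X A) (f : Cc X) (a : ∀ u, A u) (u : X) : A u :=
  ∫ γ : RFib u, f γ.toArr • S.act γ.hom (a γ.dom) ∂(haar.meas u)

end Dyn

/-! ### The reduced crossed product -/

section Reduced
variable {X : Type uX} [Groupoid.{vX} X] [TopologicalSpace X] [TopologicalSpace (Arr X)]
  {A : X → Type wA} [∀ u, NonUnitalCStarAlgebra (A u)] [TopologicalSpace (Tot A)]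
  {H : X → Type wH} [∀ u, NormedAddCommGroup (H u)] [∀ u, InnerProductSpace ℂ (H u)]
  [∀ u, CompleteSpace (H u)]

/-- `L²(G_u, λ_u; H)`. -/
abbrev L2 (haar : HaarSystem X) (u : X) (K : Type wH) [NormedAddCommGroup K] :=
  Lp K 2 (haar.smeas u)

variable (H) in
/-- The Hilbert space `⊕_u L²(G_u, λ_u; H_u)` of the direct sum of the regular representations. -/
abbrev RegSpace (haar : HaarSystem X) := lp (fun u : X => L2 haar u (H u)) 2

variable (H) in
/-- The C⋆-algebra of bounded operators on `⊕_u L²(G_u, λ_u; H_u)`. -/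
abbrev RegAlg (haar : HaarSystem X) := RegSpace H haar →L[ℂ] RegSpace H haar

/-- `T = Λ(f)`, where `Λ = ⊕_u Ind π_u` is the direct sum of the regular representations
`Ind π_u` on `L²(G_u, λ_u; H_u)` induced from representations `π_u` of the fibres `A(u)` on `H_u`:
`(Ind π_u (f) ξ)(γ) = ∫ π_u(α_γ⁻¹(f(η))) ξ(η⁻¹γ) dλ^{r(γ)}(η)`. -/
def IsRegularRep (haar : HaarSystem X) (S : DynSys X A)
    (π : ∀ u, A u →⋆ₙₐ[ℂ] (H u →L[ℂ] H u)) (f : ∀ γ : Arr X, A γ.tgt)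
    (T : RegAlg H haar) : Prop :=
  ∀ (ξ : RegSpace H haar) (u : X),
    (T ξ u : SFib u → H u) =ᵐ[haar.smeas u] fun γ =>
      ∫ η : RFib γ.cod, π u ((S.act γ.hom).symm (f η.toArr))
        ((ξ u : SFib u → H u) ⟨η.dom, γ.hom ≫ Groupoid.inv η.hom⟩) ∂(haar.meas γ.cod)

/-- The reduced crossed product `A ⋊_{α,r} G`, for faithful `π_u`: the completion of
`Γ_c(G, r^*𝒜)` for the norm given by the regular representations, realized as the C⋆-algebra
generated by the operators `Λ(f)`, `f ∈ Γ_c(G, r^*𝒜)`. -/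
def reducedCrossedProduct (haar : HaarSystem X) (S : DynSys X A)
    (π : ∀ u, A u →⋆ₙₐ[ℂ] (H u →L[ℂ] H u)) : NonUnitalStarSubalgebra ℂ (RegAlg H haar) :=
  (NonUnitalStarAlgebra.adjoin ℂ
    {T : RegAlg H haar | ∃ f, IsCcSection f ∧ IsRegularRep haar S π f T}).topologicalClosure

/-- `E`, the closed linear span of the elements `⟨a, b⟩_E`, `a, b ∈ A₀`. -/
def algE (haar : HaarSystem X) (S : DynSys X A)
    (π : ∀ u, A u →⋆ₙₐ[ℂ] (H u →L[ℂ] H u)) (A₀ : NonUnitalStarSubalgebra ℂ (∀ u, A u)) :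
    Submodule ℂ (RegAlg H haar) :=
  (Submodule.span ℂ {T : RegAlg H haar |
    ∃ a ∈ A₀, ∃ b ∈ A₀, IsRegularRep haar S π (innerE S a b) T}).topologicalClosure

end Reduced

end GpdProper

end

/-! ### Integral operators satisfying Schur's test -/

namespace Schur

variable {Y : Type*} [MeasurableSpace Y] {μ : Measure Y}

/-! Substituting `η = γζ⁻¹` and using left invariance, `Ind π_u (f)` becomes the integral operator
on `L²(G_u, λ_u; H_u)` with kernel `k(γ, ζ) = π_u(α_γ⁻¹(f(γζ⁻¹)))`. The two halves of `‖f‖_I` bound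
the row and column integrals of `‖k‖`, so Schur's test gives `‖Λ(f)‖ ≤ ‖f‖_I` for every continuous
section with `‖f‖_I < ∞` (`isKernel_regKernel`, `norm_regRep_le`). Integrable sections are
`‖·‖_I`-limits of elements of `Γ_c(G, r^*𝒜)`, so `E` lies in the reduced crossed product.

For the ideal property, write `(φ ⊗ c)(γ) = φ(γ) c(r(γ))`. Convolving with `⟨a, b⟩_E` gives `⟨c (φ ·
a), b⟩_E`, because `a` enters only through the integral defining `φ · a`
(`regRep_ccSection_mul_innerE`). If `φ ∈ C` and `c ∈ A₀`, then `c (φ · a) ∈ A₀`, so `Λ(φ ⊗ c)` maps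
`E` into itself from the left. The set of left multipliers of `E` is a norm-closed subspace. Density
of `C` in `C_c(G)` extends the claim to all `φ ∈ C_c(G)`, and `‖·‖_I`-density of the sums `∑ φ_i ⊗
c_i` extends it to all of `Γ_c(G, r^*𝒜)` (`IsCcSection.exists_sum_iNorm_lt`). Since `⟨a, b⟩_E^* =
⟨b, a⟩_E`, `E` is self-adjoint, and right multiplication follows by taking adjoints.

The density of the sums requires sections in `Γ_0(X, 𝒜)` with values close to those of a given `f ∈
Γ_c(G, r^*𝒜)`. They are produced by averaging `f` over range fibres against concentrated bump
functions, which rests on the continuity of `u ↦ ∫ f dλ^u` (`IsCcSection.continuous_integral`). -/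

theorem lintegral_sq_le [SFinite μ] {k : Y → Y → ℝ≥0∞} (hk : Measurable (Function.uncurry k))
    {M : ℝ≥0∞} (hl : ∀ x, ∫⁻ y, k x y ∂μ ≤ M) (hr : ∀ y, ∫⁻ x, k x y ∂μ ≤ M)
    {h : Y → ℝ≥0∞} (hh : Measurable h) :
    ∫⁻ x, (∫⁻ y, k x y * h y ∂μ) ^ 2 ∂μ ≤ M ^ 2 * ∫⁻ y, h y ^ 2 ∂μ := by
  have hkx : ∀ x, Measurable (k x) := fun x => hk.of_uncurry_left
  -- Cauchy–Schwarz for the factorisation `k h = k^{1/2} · (k^{1/2} h)`. It consumes the row bound;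
  -- the column bound enters after Tonelli.
  have step : ∀ x, (∫⁻ y, k x y * h y ∂μ) ^ 2 ≤ M * ∫⁻ y, k x y * h y ^ 2 ∂μ := by
    intro x
    have hold := ENNReal.lintegral_mul_le_Lp_mul_Lq μ Real.HolderConjugate.two_two
      (f := fun y => k x y ^ (1 / 2 : ℝ)) (g := fun y => k x y ^ (1 / 2 : ℝ) * h y)
      ((hkx x).pow_const _).aemeasurable (((hkx x).pow_const _).mul hh).aemeasurable
    have e1 : ∀ y, (k x y ^ (1 / 2 : ℝ)) ^ (2 : ℝ) = k x y := fun y => by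
      rw [← ENNReal.rpow_mul]; norm_num
    have e2 : ∀ y, k x y ^ (1 / 2 : ℝ) * (k x y ^ (1 / 2 : ℝ) * h y) = k x y * h y := fun y => by
      rw [← mul_assoc, ← ENNReal.rpow_add_of_nonneg _ _ (by norm_num) (by norm_num)]; norm_num
    have e3 : ∀ y, (k x y ^ (1 / 2 : ℝ) * h y) ^ (2 : ℝ) = k x y * h y ^ 2 := fun y => by
      rw [ENNReal.mul_rpow_of_nonneg _ _ (by norm_num), e1]; norm_num
    simp only [Pi.mul_apply, e1, e2, e3] at hold
    have e4 : ∀ a : ℝ≥0∞, (a ^ (1 / 2 : ℝ)) ^ 2 = a := fun a => by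
      rw [← ENNReal.rpow_natCast, ← ENNReal.rpow_mul]; norm_num
    calc (∫⁻ y, k x y * h y ∂μ) ^ 2
        ≤ ((∫⁻ y, k x y ∂μ) ^ (1 / 2 : ℝ) * (∫⁻ y, k x y * h y ^ 2 ∂μ) ^ (1 / 2 : ℝ)) ^ 2 := by
          gcongr
      _ = (∫⁻ y, k x y ∂μ) * ∫⁻ y, k x y * h y ^ 2 ∂μ := by rw [mul_pow, e4, e4]
      _ ≤ _ := by gcongr; exact hl x
  have hm : Measurable (fun p : Y × Y => k p.1 p.2 * h p.2 ^ 2) :=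
    hk.mul ((hh.comp measurable_snd).pow_const 2)
  calc ∫⁻ x, (∫⁻ y, k x y * h y ∂μ) ^ 2 ∂μ
      ≤ ∫⁻ x, M * ∫⁻ y, k x y * h y ^ 2 ∂μ ∂μ := lintegral_mono step
    _ = M * ∫⁻ x, ∫⁻ y, k x y * h y ^ 2 ∂μ ∂μ :=
        lintegral_const_mul _ hm.lintegral_prod_right'
    _ = M * ∫⁻ y, ∫⁻ x, k x y * h y ^ 2 ∂μ ∂μ := by
        rw [lintegral_lintegral_swap hm.aemeasurable]
    _ = M * ∫⁻ y, (∫⁻ x, k x y ∂μ) * h y ^ 2 ∂μ := by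
        congr 1
        exact lintegral_congr fun y => lintegral_mul_const _ hk.of_uncurry_right
    _ ≤ M * ∫⁻ y, M * h y ^ 2 ∂μ := by
        gcongr with y; exact hr y
    _ = M ^ 2 * ∫⁻ y, h y ^ 2 ∂μ := by
        rw [lintegral_const_mul _ (hh.pow_const 2), ← mul_assoc, sq]

theorem _root_.MeasureTheory.Lp.lintegral_sq_enorm {E : Type*} [NormedAddCommGroup E] (ξ : Lp E 2 μ) :
    ∫⁻ y, ‖ξ y‖ₑ ^ 2 ∂μ = ‖ξ‖ₑ ^ 2 := by
  rw [Lp.enorm_def, eLpNorm_eq_lintegral_rpow_enorm_toReal (by norm_num) (by norm_num),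
    ← ENNReal.rpow_natCast, ← ENNReal.rpow_mul]
  norm_num

variable {H : Type*} [NormedAddCommGroup H] [InnerProductSpace ℂ H]

/-- The kernel `K` is measurable and satisfies the hypotheses of Schur's test with constant `M`. -/
structure IsKernel (μ : Measure Y) (K : Y → Y → H →L[ℂ] H) (M : ℝ≥0∞) : Prop where
  meas : StronglyMeasurable (Function.uncurry K)
  lt_top : M < ∞
  left : ∀ x, ∫⁻ y, ‖K x y‖ₑ ∂μ ≤ M
  right : ∀ y, ∫⁻ x, ‖K x y‖ₑ ∂μ ≤ M

namespace IsKernel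

variable {K L : Y → Y → H →L[ℂ] H} {M N : ℝ≥0∞}

theorem measurable_enorm (hK : IsKernel μ K M) :
    Measurable (Function.uncurry fun x y => ‖K x y‖ₑ) := hK.meas.enorm

theorem stronglyMeasurable_apply (hK : IsKernel μ K M) {ξ : Y → H} (hξ : StronglyMeasurable ξ) :
    StronglyMeasurable (fun p : Y × Y => K p.1 p.2 (ξ p.2)) :=
  isBoundedBilinearMap_apply.continuous.comp_stronglyMeasurable
    (hK.meas.prodMk (hξ.comp_measurable measurable_snd))

theorem adjoint [CompleteSpace H] (hK : IsKernel μ K M) :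
    IsKernel μ (fun x y => ContinuousLinearMap.adjoint (K y x)) M where
  meas := ContinuousLinearMap.adjoint.continuous.comp_stronglyMeasurable
    (hK.meas.comp_measurable measurable_swap)
  lt_top := hK.lt_top
  left x := by simpa only [LinearIsometryEquiv.enorm_map] using hK.right x
  right y := by simpa only [LinearIsometryEquiv.enorm_map] using hK.left y

theorem lintegral_sq_apply_le [SFinite μ] (hK : IsKernel μ K M) {ξ : Y → H}
    (hξ : StronglyMeasurable ξ) :
    ∫⁻ x, (∫⁻ y, ‖K x y‖ₑ * ‖ξ y‖ₑ ∂μ) ^ 2 ∂μ ≤ M ^ 2 * ∫⁻ y, ‖ξ y‖ₑ ^ 2 ∂μ :=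
  lintegral_sq_le hK.measurable_enorm hK.left hK.right hξ.enorm

theorem ae_lintegral_lt_top [SFinite μ] {k : Y → Y → ℝ≥0∞}
    (hk : Measurable (Function.uncurry k)) {h : Y → ℝ≥0∞} (hh : Measurable h)
    (hfin : ∫⁻ x, (∫⁻ y, k x y * h y ∂μ) ^ 2 ∂μ ≠ ∞) :
    ∀ᵐ x ∂μ, ∫⁻ y, k x y * h y ∂μ < ∞ := by
  have hm : Measurable (fun x => ∫⁻ y, k x y * h y ∂μ) :=
    (hk.mul (hh.comp measurable_snd) : Measurable
      (fun p : Y × Y => k p.1 p.2 * h p.2)).lintegral_prod_right'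
  filter_upwards [ae_lt_top (hm.pow_const 2) hfin] with x hx
  by_contra hcon
  simp [not_lt_top_iff.1 hcon] at hx

theorem ae_integrable [SFinite μ] (hK : IsKernel μ K M) (ξ : Lp H 2 μ) :
    ∀ᵐ x ∂μ, Integrable (fun y => K x y (ξ y)) μ := by
  have hξ := Lp.stronglyMeasurable ξ
  have hfin := (hK.lintegral_sq_apply_le hξ).trans_lt
    (ENNReal.mul_lt_top (ENNReal.pow_lt_top hK.lt_top)
      (by rw [Lp.lintegral_sq_enorm]; exact ENNReal.pow_lt_top enorm_lt_top))
  filter_upwards [ae_lintegral_lt_top hK.measurable_enorm hξ.enorm hfin.ne] with x hx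
  refine ⟨((hK.stronglyMeasurable_apply hξ).comp_measurable
    measurable_prodMk_left).aestronglyMeasurable, lt_of_le_of_lt (lintegral_mono fun y => ?_) hx⟩
  exact (K x y).le_opENorm (ξ y)

theorem eLpNorm_integral_le [SFinite μ] (hK : IsKernel μ K M) (ξ : Lp H 2 μ) :
    eLpNorm (fun x => ∫ y, K x y (ξ y) ∂μ) 2 μ ≤ M * ‖ξ‖ₑ := by
  have hξ := Lp.stronglyMeasurable ξ
  rw [eLpNorm_eq_lintegral_rpow_enorm_toReal (by norm_num) (by norm_num)]
  have key : ∫⁻ x, ‖∫ y, K x y (ξ y) ∂μ‖ₑ ^ (2 : ℝ≥0∞).toReal ∂μ ≤ (M * ‖ξ‖ₑ) ^ (2 : ℝ) := by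
    calc _ ≤ ∫⁻ x, (∫⁻ y, ‖K x y‖ₑ * ‖ξ y‖ₑ ∂μ) ^ 2 ∂μ := by
          refine lintegral_mono fun x => ?_
          have h1 : ‖∫ y, K x y (ξ y) ∂μ‖ₑ ≤ ∫⁻ y, ‖K x y‖ₑ * ‖ξ y‖ₑ ∂μ :=
            (enorm_integral_le_lintegral_enorm _).trans
              (lintegral_mono fun y => (K x y).le_opENorm (ξ y))
          have h2 : (2 : ℝ≥0∞).toReal = (2 : ℕ) := by norm_num
          simp only [h2, ENNReal.rpow_natCast]
          gcongr
      _ ≤ _ := by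
          refine (hK.lintegral_sq_apply_le hξ).trans_eq ?_
          rw [Lp.lintegral_sq_enorm, ← mul_pow, ← ENNReal.rpow_natCast]
          norm_num
  refine (ENNReal.rpow_le_rpow key (by norm_num)).trans_eq ?_
  rw [← ENNReal.rpow_mul]
  norm_num

theorem memLp [SFinite μ] (hK : IsKernel μ K M) (ξ : Lp H 2 μ) :
    MemLp (fun x => ∫ y, K x y (ξ y) ∂μ) 2 μ :=
  ⟨(hK.stronglyMeasurable_apply (Lp.stronglyMeasurable ξ)).integral_prod_right.aestronglyMeasurable,
    (hK.eLpNorm_integral_le ξ).trans_lt (ENNReal.mul_lt_top hK.lt_top enorm_lt_top)⟩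

/-- The integral operator with kernel `K` on `L²`. -/
noncomputable def toCLM [SFinite μ] (hK : IsKernel μ K M) : Lp H 2 μ →L[ℂ] Lp H 2 μ :=
  LinearMap.mkContinuous
    { toFun := fun ξ => (hK.memLp ξ).toLp _
      map_add' := fun ξ η => by
        rw [← MemLp.toLp_add]
        refine MemLp.toLp_congr _ _ ?_
        filter_upwards [hK.ae_integrable ξ, hK.ae_integrable η] with x h1 h2
        rw [Pi.add_apply, ← integral_add h1 h2]
        refine integral_congr_ae ?_
        filter_upwards [Lp.coeFn_add ξ η] with y hy
        rw [hy, Pi.add_apply, map_add]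
      map_smul' := fun c ξ => by
        rw [RingHom.id_apply, ← MemLp.toLp_const_smul]
        refine MemLp.toLp_congr _ _ (Eventually.of_forall fun x => ?_)
        simp only [Pi.smul_apply]
        rw [← integral_smul]
        refine integral_congr_ae ?_
        filter_upwards [Lp.coeFn_smul c ξ] with y hy
        rw [hy, Pi.smul_apply, map_smul] }
    M.toReal fun ξ => by
      simp only [LinearMap.coe_mk, AddHom.coe_mk]
      rw [Lp.norm_toLp]
      refine (ENNReal.toReal_mono (ENNReal.mul_lt_top hK.lt_top enorm_lt_top).ne
        (hK.eLpNorm_integral_le ξ)).trans_eq ?_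
      rw [ENNReal.toReal_mul, toReal_enorm]

theorem toCLM_ae [SFinite μ] (hK : IsKernel μ K M) (ξ : Lp H 2 μ) :
    hK.toCLM ξ =ᵐ[μ] fun x => ∫ y, K x y (ξ y) ∂μ := (hK.memLp ξ).coeFn_toLp

theorem norm_toCLM_le [SFinite μ] (hK : IsKernel μ K M) : ‖hK.toCLM‖ ≤ M.toReal :=
  LinearMap.mkContinuous_norm_le _ ENNReal.toReal_nonneg _

/-- Fubini for `⟨K(x,y)ξ(y), η(x)⟩`. Absolute integrability holds because `x ↦ ∫ ‖K(x,y)‖ ‖ξ(y)‖ dy`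
is in `L²` by Schur's test and is paired with `‖η‖ ∈ L²`. -/
theorem inner_toCLM [SFinite μ] [CompleteSpace H] (hK : IsKernel μ K M) (ξ η : Lp H 2 μ) :
    inner ℂ (hK.toCLM ξ) η = inner ℂ ξ (hK.adjoint.toCLM η) := by
  have hξ := Lp.stronglyMeasurable ξ
  have hη := Lp.stronglyMeasurable η
  have hint : Integrable (Function.uncurry fun x y => inner ℂ (K x y (ξ y)) (η x)) (μ.prod μ) := by
    have hmeas : StronglyMeasurable (Function.uncurry fun x y => inner ℂ (K x y (ξ y)) (η x)) :=
      (hK.stronglyMeasurable_apply hξ).inner (hη.comp_measurable measurable_fst)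
    refine ⟨hmeas.aestronglyMeasurable, ?_⟩
    have hkm : Measurable fun p : Y × Y => ‖K p.1 p.2‖ₑ * ‖ξ p.2‖ₑ :=
      hK.measurable_enorm.mul (hξ.enorm.comp measurable_snd)
    have hb := lintegral_prod (μ := μ) (ν := μ)
      (fun p : Y × Y => ‖K p.1 p.2‖ₑ * ‖ξ p.2‖ₑ * ‖η p.1‖ₑ)
      (hkm.mul (hη.enorm.comp measurable_fst)).aemeasurable
    have hb2 : ∫⁻ x, (∫⁻ y, ‖K x y‖ₑ * ‖ξ y‖ₑ ∂μ) * ‖η x‖ₑ ∂μ < ∞ := by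
      refine (ENNReal.lintegral_mul_le_Lp_mul_Lq μ Real.HolderConjugate.two_two
        hkm.lintegral_prod_right'.aemeasurable hη.enorm.aemeasurable).trans_lt ?_
      have h2 : (2 : ℝ) = (2 : ℕ) := by norm_num
      rw [h2]
      simp only [ENNReal.rpow_natCast]
      rw [Lp.lintegral_sq_enorm]
      have h3 := (hK.lintegral_sq_apply_le hξ).trans_lt
        (ENNReal.mul_lt_top (ENNReal.pow_lt_top hK.lt_top)
          (by rw [Lp.lintegral_sq_enorm]; exact ENNReal.pow_lt_top enorm_lt_top))
      exact ENNReal.mul_lt_top (ENNReal.rpow_lt_top_of_nonneg (by positivity) h3.ne)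
        (ENNReal.rpow_lt_top_of_nonneg (by positivity) (ENNReal.pow_lt_top enorm_lt_top).ne)
    refine lt_of_le_of_lt (lintegral_mono fun p => ?_) (lt_of_eq_of_lt (hb.trans ?_) hb2)
    · exact (show ‖inner ℂ (K p.1 p.2 (ξ p.2)) (η p.1)‖ₑ
          ≤ ‖K p.1 p.2 (ξ p.2)‖ₑ * ‖η p.1‖ₑ from by
            simp only [← ofReal_norm]
            rw [← ENNReal.ofReal_mul (norm_nonneg _)]
            exact ENNReal.ofReal_le_ofReal (norm_inner_le_norm _ _)).trans (by gcongr; exact (K p.1 p.2).le_opENorm _)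
    · exact lintegral_congr fun x =>
        lintegral_mul_const (‖η x‖ₑ) (hkm.comp (measurable_prodMk_left (x := x)))
  rw [L2.inner_def, L2.inner_def]
  calc ∫ x, inner ℂ (hK.toCLM ξ x) (η x) ∂μ
      = ∫ x, ∫ y, inner ℂ (K x y (ξ y)) (η x) ∂μ ∂μ := by
        refine integral_congr_ae ?_
        filter_upwards [hK.toCLM_ae ξ, hK.ae_integrable ξ] with x hx hi
        rw [hx, ← inner_conj_symm, ← integral_inner hi, ← integral_conj]
        simp only [inner_conj_symm]
    _ = ∫ y, ∫ x, inner ℂ (K x y (ξ y)) (η x) ∂μ ∂μ := integral_integral_swap hint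
    _ = ∫ y, inner ℂ (ξ y) (hK.adjoint.toCLM η y) ∂μ := by
        refine integral_congr_ae ?_
        filter_upwards [hK.adjoint.toCLM_ae η, hK.adjoint.ae_integrable η] with y hy hi
        rw [hy, ← integral_inner hi]
        simp only [ContinuousLinearMap.adjoint_inner_right]

/-- Fubini again: applying the Schur estimate twice to the norms shows that `‖K(x,y)‖ ‖L(y,z)‖
‖ξ(z)‖` is integrable in `(y,z)` for almost every `x`. The product kernel `P` itself need not be
known to satisfy Schur's test. -/
theorem toCLM_toCLM_ae [SFinite μ] [CompleteSpace H] (hK : IsKernel μ K M) (hL : IsKernel μ L N)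
    {P : Y → Y → H →L[ℂ] H} (hint : ∀ x z, Integrable (fun y => K x y * L y z) μ)
    (hP : ∀ x z, P x z = ∫ y, K x y * L y z ∂μ) (ξ : Lp H 2 μ) :
    hK.toCLM (hL.toCLM ξ) =ᵐ[μ] fun x => ∫ z, P x z (ξ z) ∂μ := by
  have hξ := Lp.stronglyMeasurable ξ
  set n : Y → ℝ≥0∞ := fun y => ∫⁻ z, ‖L y z‖ₑ * ‖ξ z‖ₑ ∂μ with hn
  have hlm : Measurable fun p : Y × Y => ‖L p.1 p.2‖ₑ * ‖ξ p.2‖ₑ :=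
    hL.measurable_enorm.mul (hξ.enorm.comp measurable_snd)
  have hnm : Measurable n := hlm.lintegral_prod_right'
  have hn2 : ∫⁻ y, n y ^ 2 ∂μ < ∞ := (hL.lintegral_sq_apply_le hξ).trans_lt
    (ENNReal.mul_lt_top (ENNReal.pow_lt_top hL.lt_top)
      (by rw [Lp.lintegral_sq_enorm]; exact ENNReal.pow_lt_top enorm_lt_top))
  have hfin := (lintegral_sq_le hK.measurable_enorm hK.left hK.right hnm).trans_lt
    (ENNReal.mul_lt_top (ENNReal.pow_lt_top hK.lt_top) hn2)
  filter_upwards [hK.toCLM_ae (hL.toCLM ξ),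
    ae_lintegral_lt_top hK.measurable_enorm hnm hfin.ne] with x hx hxfin
  rw [hx]
  have hLξ := hL.stronglyMeasurable_apply hξ
  have hmeas : StronglyMeasurable (fun p : Y × Y => K x p.1 (L p.1 p.2 (ξ p.2))) :=
    isBoundedBilinearMap_apply.continuous.comp_stronglyMeasurable
      ((hK.meas.comp_measurable (measurable_prodMk_left.comp measurable_fst)).prodMk hLξ)
  have hprod : Integrable (Function.uncurry fun y z => K x y (L y z (ξ z))) (μ.prod μ) := by
    refine ⟨hmeas.aestronglyMeasurable, ?_⟩
    have hKx : Measurable fun y => ‖K x y‖ₑ := hK.measurable_enorm.of_uncurry_left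
    have hb := lintegral_prod (μ := μ) (ν := μ)
      (fun p : Y × Y => ‖K x p.1‖ₑ * (‖L p.1 p.2‖ₑ * ‖ξ p.2‖ₑ))
      ((hKx.comp measurable_fst).mul hlm).aemeasurable
    refine lt_of_le_of_lt (lintegral_mono fun p => ?_) (lt_of_eq_of_lt (hb.trans ?_) hxfin)
    · exact ((K x p.1).le_opENorm _).trans (by gcongr; exact (L p.1 p.2).le_opENorm _)
    · exact lintegral_congr fun y => lintegral_const_mul (‖K x y‖ₑ) (hlm.comp (measurable_prodMk_left (x := y)))
  calc ∫ y, K x y (hL.toCLM ξ y) ∂μ = ∫ y, ∫ z, K x y (L y z (ξ z)) ∂μ ∂μ := by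
        refine integral_congr_ae ?_
        filter_upwards [hL.toCLM_ae ξ, hL.ae_integrable ξ] with y hy hi
        rw [hy, ContinuousLinearMap.integral_comp_comm _ hi]
    _ = ∫ z, ∫ y, K x y (L y z (ξ z)) ∂μ ∂μ := integral_integral_swap hprod
    _ = ∫ z, P x z (ξ z) ∂μ := by
        refine integral_congr_ae (Eventually.of_forall fun z => ?_)
        simp only [hP]
        rw [ContinuousLinearMap.integral_apply (hint x z)]
        rfl

end IsKernel
end Schur

/-! ### Upper semicontinuous C⋆-bundles -/

namespace GpdProper

section Bundle

theorem tendsto_fibProd_iff {X : Type*} {A : X → Type*} [TopologicalSpace (Tot A)] {Z : Type*} {l : Filter Z}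
    {q : Z → FibProd A} {p : FibProd A} :
    Tendsto q l (𝓝 p) ↔
      Tendsto (fun z => (⟨(q z).base, (q z).fst⟩ : Tot A)) l (𝓝 ⟨p.base, p.fst⟩) ∧
      Tendsto (fun z => (⟨(q z).base, (q z).snd⟩ : Tot A)) l (𝓝 ⟨p.base, p.snd⟩) := by
  rw [nhds_induced, tendsto_comap_iff, Prod.tendsto_iff]
  rfl

variable {X : Type*} [TopologicalSpace X] {A : X → Type*}
  [∀ u, NonUnitalCStarAlgebra (A u)] [TopologicalSpace (Tot A)]

/-- The section `c` is continuous at `v` up to the error `e`. -/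
def IsApproxContAt (c : ∀ u, A u) (v : X) (e : X → ℝ) : Prop :=
  ∃ z : A v, ∀ W ∈ 𝓝 (⟨v, z⟩ : Tot A), ∀ᶠ u in 𝓝 v, ∃ w : A u, (⟨u, w⟩ : Tot A) ∈ W ∧
    ‖c u - w‖ ≤ e u

theorem IsApproxContAt.mono {c : ∀ u, A u} {v : X} {e e' : X → ℝ} (h : IsApproxContAt c v e)
    (he : ∀ᶠ u in 𝓝 v, e u ≤ e' u) : IsApproxContAt c v e' := by
  obtain ⟨z, hz⟩ := h
  refine ⟨z, fun W hW => ?_⟩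
  filter_upwards [hz W hW, he] with u ⟨w, hw, hc⟩ hu
  exact ⟨w, hw, hc.trans hu⟩

variable [IsUSCStarBundle A] {Z : Type*} {l : Filter Z} {b : Z → X} {x y : ∀ z, A (b z)}
  {u : X} {x₀ y₀ : A u}

theorem tendsto_base (hx : Tendsto (fun z => (⟨b z, x z⟩ : Tot A)) l (𝓝 ⟨u, x₀⟩)) :
    Tendsto b l (𝓝 u) :=
  (IsUSCStarBundle.continuous_proj (A := A)).continuousAt.tendsto.comp hx

theorem tendsto_add (hx : Tendsto (fun z => (⟨b z, x z⟩ : Tot A)) l (𝓝 ⟨u, x₀⟩))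
    (hy : Tendsto (fun z => (⟨b z, y z⟩ : Tot A)) l (𝓝 ⟨u, y₀⟩)) :
    Tendsto (fun z => (⟨b z, x z + y z⟩ : Tot A)) l (𝓝 ⟨u, x₀ + y₀⟩) :=
  ((IsUSCStarBundle.continuous_add (A := A)).tendsto ⟨u, x₀, y₀⟩).comp
    (tendsto_fibProd_iff (q := fun z => ⟨b z, x z, y z⟩).2 ⟨hx, hy⟩)

theorem tendsto_const_smul (k : ℂ)
    (hx : Tendsto (fun z => (⟨b z, x z⟩ : Tot A)) l (𝓝 ⟨u, x₀⟩)) :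
    Tendsto (fun z => (⟨b z, k • x z⟩ : Tot A)) l (𝓝 ⟨u, k • x₀⟩) :=
  ((IsUSCStarBundle.continuous_smul (A := A) k).tendsto ⟨u, x₀⟩).comp hx

theorem tendsto_sub (hx : Tendsto (fun z => (⟨b z, x z⟩ : Tot A)) l (𝓝 ⟨u, x₀⟩))
    (hy : Tendsto (fun z => (⟨b z, y z⟩ : Tot A)) l (𝓝 ⟨u, y₀⟩)) :
    Tendsto (fun z => (⟨b z, x z - y z⟩ : Tot A)) l (𝓝 ⟨u, x₀ - y₀⟩) := by
  simpa only [neg_one_smul, ← sub_eq_add_neg] using tendsto_add hx (tendsto_const_smul (-1) hy)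

theorem eventually_norm_lt (hx : Tendsto (fun z => (⟨b z, x z⟩ : Tot A)) l (𝓝 ⟨u, x₀⟩))
    {c : ℝ} (hc : ‖x₀‖ < c) : ∀ᶠ z in l, ‖x z‖ < c :=
  hx.eventually (IsUSCStarBundle.usc_norm (A := A) ⟨u, x₀⟩ c hc)

theorem tendsto_zero_of_norm (hx : Tendsto (fun z => ‖x z‖) l (𝓝 0)) (hb : Tendsto b l (𝓝 u)) :
    Tendsto (fun z => (⟨b z, x z⟩ : Tot A)) l (𝓝 ⟨u, 0⟩) :=
  IsUSCStarBundle.tendsto_zero (A := A) (map (fun z => (⟨b z, x z⟩ : Tot A)) l) u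
    (tendsto_map'_iff.2 hx) (tendsto_map'_iff.2 hb)

/-- The bundle axioms only give continuity for a fixed scalar. The remainder `(k - k₀) x` tends to
zero in norm, since upper semicontinuity keeps `‖x‖` below `‖x₀‖ + 1`, and elements of small norm
converge to the zero section. -/
theorem tendsto_smul {k : Z → ℂ} {k₀ : ℂ} (hk : Tendsto k l (𝓝 k₀))
    (hx : Tendsto (fun z => (⟨b z, x z⟩ : Tot A)) l (𝓝 ⟨u, x₀⟩)) :
    Tendsto (fun z => (⟨b z, k z • x z⟩ : Tot A)) l (𝓝 ⟨u, k₀ • x₀⟩) := by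
  have h0 : Tendsto (fun z => ‖(k z - k₀) • x z‖) l (𝓝 0) := by
    have h1 : Tendsto (fun z => ‖k z - k₀‖ * (‖x₀‖ + 1)) l (𝓝 0) := by
      have := ((hk.sub_const k₀).norm).mul_const (‖x₀‖ + 1)
      simpa using this
    refine squeeze_zero' (Eventually.of_forall fun z => norm_nonneg _) ?_ h1
    filter_upwards [eventually_norm_lt hx (lt_add_one ‖x₀‖)] with z hz
    rw [norm_smul]
    gcongr
  have := tendsto_add (tendsto_const_smul k₀ hx) (tendsto_zero_of_norm h0 (tendsto_base hx))
  simpa only [← add_smul, add_sub_cancel, add_zero] using this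

/-- The topology of the fibres is the norm topology. -/
theorem continuous_fibre [TopologicalSpace Z] {g : Z → A u}
    (hg : Continuous (fun z => (⟨u, g z⟩ : Tot A))) : Continuous g := by
  refine continuous_iff_continuousAt.2 fun z₀ => Metric.tendsto_nhds.2 fun ε hε => ?_
  have h := tendsto_sub (hg.tendsto z₀) (tendsto_const_nhds (x := (⟨u, g z₀⟩ : Tot A)))
  filter_upwards [eventually_norm_lt h (c := ε) (by simpa using hε)] with z hz
  rwa [dist_eq_norm]

theorem continuous_zero_section : Continuous (fun u => (⟨u, 0⟩ : Tot A)) :=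
  continuous_iff_continuousAt.2 fun _ =>
    tendsto_zero_of_norm (A := A) (x := fun u => (0 : A u)) (by simp) tendsto_id

/-- Every point of the total space has neighbourhoods whose slices have small diameter. -/
theorem exists_isOpen_norm_sub_lt (z : Tot A) {δ : ℝ} (hδ : 0 < δ) :
    ∃ W : Set (Tot A), IsOpen W ∧ z ∈ W ∧ ∀ u, ∀ w w' : A u,
      (⟨u, w⟩ : Tot A) ∈ W → (⟨u, w'⟩ : Tot A) ∈ W → ‖w - w'‖ < δ := by
  have hid : Tendsto id (𝓝 (⟨z.base, z.val, z.val⟩ : FibProd A)) (𝓝 _) := tendsto_id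
  rw [tendsto_fibProd_iff] at hid
  -- On the fibred product, `(w, w') ↦ ‖w - w'‖` is upper semicontinuous and vanishes at `(z, z)`.
  have h := eventually_norm_lt (tendsto_sub hid.1 hid.2) (c := δ) (by simpa using hδ)
  rw [nhds_induced, Filter.eventually_comap, nhds_prod_eq] at h
  obtain ⟨U, hU, hUV⟩ := Filter.mem_prod_same_iff.1 h
  obtain ⟨W, hWU, hWo, hzW⟩ := mem_nhds_iff.1 hU
  exact ⟨W, hWo, hzW, fun u w w' hw hw' =>
    hUV (Set.mk_mem_prod (hWU hw) (hWU hw')) ⟨u, w, w'⟩ rfl⟩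

theorem exists_nhds_add_mem {O : Set (Tot A)} (hO : O ∈ 𝓝 (⟨u, x₀ + y₀⟩ : Tot A)) :
    ∃ W ∈ 𝓝 (⟨u, x₀⟩ : Tot A), ∃ D ∈ 𝓝 (⟨u, y₀⟩ : Tot A), ∀ v, ∀ w d : A v,
      (⟨v, w⟩ : Tot A) ∈ W → (⟨v, d⟩ : Tot A) ∈ D → (⟨v, w + d⟩ : Tot A) ∈ O := by
  have h := (IsUSCStarBundle.continuous_add (A := A)).tendsto ⟨u, x₀, y₀⟩ hO
  rw [mem_map, nhds_induced, Filter.mem_comap] at h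
  obtain ⟨U, hU, hUO⟩ := h
  obtain ⟨W, hW, D, hD, hWD⟩ := mem_nhds_prod_iff.1 hU
  exact ⟨W, hW, D, hD, fun v w d hw hd =>
    hUO (show (⟨v, w, d⟩ : FibProd A) ∈ _ from hWD (Set.mk_mem_prod hw hd))⟩

/-- Every neighbourhood of a point contains the thickening of a smaller one. -/
theorem exists_nhds_thickening {O : Set (Tot A)} (hO : O ∈ 𝓝 (⟨u, x₀⟩ : Tot A)) :
    ∃ ε > 0, ∃ W ∈ 𝓝 (⟨u, x₀⟩ : Tot A), ∀ v, ∀ w x : A v,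
      (⟨v, w⟩ : Tot A) ∈ W → ‖x - w‖ < ε → (⟨v, x⟩ : Tot A) ∈ O := by
  obtain ⟨W, hW, N, hN, hWN⟩ := exists_nhds_add_mem (x₀ := x₀) (y₀ := 0) (O := O) (by rwa [add_zero])
  -- The zero axiom, applied to the filter of tubes `‖z‖ < ε`, `z.base ∈ U`, shows that such a tube
  -- lies inside `N`.
  have hle := IsUSCStarBundle.tendsto_zero (A := A)
    (comap (fun z : Tot A => ‖z.val‖) (𝓝 0) ⊓ comap (fun z : Tot A => z.base) (𝓝 u)) u
    (tendsto_comap.mono_left inf_le_left) (tendsto_comap.mono_left inf_le_right) hN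
  obtain ⟨s, ⟨t, ht, hts⟩, r, ⟨U, hU, hUr⟩, hsr⟩ := Filter.mem_inf_iff.1 hle
  obtain ⟨ε, hε, hεt⟩ := Metric.mem_nhds_iff.1 ht
  refine ⟨ε, hε, W ∩ {z | z.base ∈ U}, inter_mem hW
    ((IsUSCStarBundle.continuous_proj (A := A)).tendsto (⟨u, x₀⟩ : Tot A) hU), ?_⟩
  rintro v w x ⟨hw, hv⟩ hxw
  have := hWN v w (x - w) hw (by
    rw [hsr]
    exact ⟨hts (hεt (by simpa using hxw)), hUr hv⟩)
  rwa [add_sub_cancel] at this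

theorem eventually_exists_mem {W : Set (Tot A)} (hW : W ∈ 𝓝 (⟨u, x₀⟩ : Tot A)) :
    ∀ᶠ v in 𝓝 u, ∃ w : A v, (⟨v, w⟩ : Tot A) ∈ W := by
  filter_upwards [(IsUSCStarBundle.isOpenMap_proj (A := A)).image_mem_nhds hW] with v hv
  obtain ⟨⟨_, w⟩, hw, rfl⟩ := hv
  exact ⟨w, hw⟩

theorem IsApproxContAt.add {c c' : ∀ u, A u} {v : X} {e e' : X → ℝ} (h : IsApproxContAt c v e)
    (h' : IsApproxContAt c' v e') : IsApproxContAt (c + c') v (e + e') := by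
  obtain ⟨z, hz⟩ := h
  obtain ⟨z', hz'⟩ := h'
  refine ⟨z + z', fun W hW => ?_⟩
  obtain ⟨W₁, hW₁, W₂, hW₂, hadd⟩ := exists_nhds_add_mem hW
  filter_upwards [hz W₁ hW₁, hz' W₂ hW₂] with u ⟨w, hw, hc⟩ ⟨w', hw', hc'⟩
  refine ⟨w + w', hadd u w w' hw hw', ?_⟩
  simp only [Pi.add_apply]
  rw [add_sub_add_comm]
  exact (norm_add_le _ _).trans (add_le_add hc hc')

theorem isApproxContAt_zero (v : X) : IsApproxContAt (0 : ∀ u, A u) v 0 := by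
  refine ⟨0, fun W hW => ?_⟩
  filter_upwards [(continuous_zero_section (A := A)).tendsto v hW] with u hu
  exact ⟨0, hu, by simp⟩

theorem IsApproxContAt.sum {ι : Type*} (s : Finset ι) {c : ι → ∀ u, A u} {v : X} {e : ι → X → ℝ}
    (h : ∀ i ∈ s, IsApproxContAt (c i) v (e i)) :
    IsApproxContAt (∑ i ∈ s, c i) v (∑ i ∈ s, e i) := by
  classical
  induction s using Finset.induction_on with
  | empty => simpa using isApproxContAt_zero v
  | insert i s hi ih =>
    rw [Finset.sum_insert hi, Finset.sum_insert hi]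
    exact (h i (Finset.mem_insert_self i s)).add
      (ih fun j hj => h j (Finset.mem_insert_of_mem hj))

/-- A uniform-limit theorem without local triviality. The approximating point `z` over `v` need not
equal `c v` and may depend on `ε`, so the argument bounds the discrepancy `c v - z`, extends it to
nearby fibres by a small `y`, and adds it back. -/
theorem continuousAt_of_isApproxContAt {c : ∀ u, A u} {v : X}
    (h : ∀ ε > 0, IsApproxContAt c v fun _ => ε) :
    ContinuousAt (fun u => (⟨u, c u⟩ : Tot A)) v := by
  intro O hO
  obtain ⟨ε, hε, W, hW, hWO⟩ := exists_nhds_thickening hO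
  obtain ⟨z, hz⟩ := h (ε / 4) (by positivity)
  have hd : ‖c v - z‖ < ε / 2 := by
    obtain ⟨W', hWo, hzW, hthin⟩ := exists_isOpen_norm_sub_lt (⟨v, z⟩ : Tot A)
      (δ := ε / 4) (by positivity)
    -- The approximation is evaluated at `u = v` itself; thinness of `W'` then compares `w` with
    -- `z`.
    obtain ⟨w, hw, hcw⟩ := (hz W' (hWo.mem_nhds hzW)).self_of_nhds
    calc ‖c v - z‖ = ‖(c v - w) + (w - z)‖ := by rw [sub_add_sub_cancel]
      _ ≤ ‖c v - w‖ + ‖w - z‖ := norm_add_le _ _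
      _ < ε / 4 + ε / 4 := add_lt_add_of_le_of_lt hcw (hthin v w z hw hzW)
      _ = ε / 2 := by ring
  obtain ⟨W₁, hW₁, D, hD, hadd⟩ := exists_nhds_add_mem (x₀ := z) (y₀ := c v - z) (O := W)
    (by rwa [add_sub_cancel])
  have hD' : D ∩ {y : Tot A | ‖y.val‖ < ε / 2} ∈ 𝓝 (⟨v, c v - z⟩ : Tot A) :=
    inter_mem hD (IsUSCStarBundle.usc_norm (A := A) ⟨v, c v - z⟩ _ hd)
  -- Openness of the projection supplies, over every nearby `u`, some `y` in the chosen
  -- neighbourhood of `c v - z`. Then `w + y ∈ W`, at distance less than `ε / 4 + ε / 2` from `c u`.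
  rw [mem_map]
  filter_upwards [hz W₁ hW₁, eventually_exists_mem hD'] with u ⟨w, hw, hcw⟩ ⟨y, hyD, hy⟩
  refine hWO u (w + y) (c u) (hadd u w y hw hyD) ?_
  calc ‖c u - (w + y)‖ = ‖(c u - w) - y‖ := by rw [sub_sub]
    _ ≤ ‖c u - w‖ + ‖y‖ := norm_sub_le _ _
    _ < ε / 4 + ε / 2 := add_lt_add_of_le_of_lt hcw hy
    _ < ε := by linarith

end Bundle

end GpdProper

/-! ### Topological groupoids and Haar systems -/

namespace GpdProper

section Grpd

variable {X : Type*} [Groupoid X] [TopologicalSpace (Arr X)]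

theorem RFib.continuous_toArr (u : X) : Continuous (RFib.toArr (u := u)) := continuous_induced_dom

theorem SFib.continuous_toArr (u : X) : Continuous (SFib.toArr (u := u)) := continuous_induced_dom

theorem RFib.continuous_mk {Z : Type*} [TopologicalSpace Z] {u : X} {a : Z → X}
    {f : ∀ z, a z ⟶ u} (hf : Continuous (fun z => (⟨a z, u, f z⟩ : Arr X))) :
    Continuous (fun z => (⟨a z, f z⟩ : RFib u)) :=
  continuous_induced_rng.2 hf

theorem SFib.continuous_mk {Z : Type*} [TopologicalSpace Z] {u : X} {a : Z → X}
    {f : ∀ z, u ⟶ a z} (hf : Continuous (fun z => (⟨u, a z, f z⟩ : Arr X))) :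
    Continuous (fun z => (⟨a z, f z⟩ : SFib u)) :=
  continuous_induced_rng.2 hf

variable [TopologicalSpace X]

theorem HaarSystem.continuous_integral_real (haar : HaarSystem X) {f : Arr X → ℝ} (hf : Continuous f)
    (hcs : HasCompactSupport f) : Continuous fun u => ∫ γ : RFib u, f γ.toArr ∂(haar.meas u) := by
  have h := haar.continuous_integral (⟨⟨fun γ => (f γ : ℂ), Complex.continuous_ofReal.comp hf⟩,
    hcs.comp_left (g := fun x : ℝ => (x : ℂ)) (by simp)⟩ : Cc X)
  have h2 : (fun u => ∫ γ : RFib u, f γ.toArr ∂(haar.meas u))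
      = fun u => (∫ γ : RFib u, ((f γ.toArr : ℝ) : ℂ) ∂(haar.meas u)).re := by
    ext u
    rw [integral_complex_ofReal, Complex.ofReal_re]
  rw [h2]
  exact Complex.continuous_re.comp h

variable [IsTopGroupoid X]

/-- The integral is continuous in `u` and vanishes off the compact set `r(supp f)`. -/
theorem HaarSystem.exists_integral_le (haar : HaarSystem X) {f : Arr X → ℝ} (hf : Continuous f)
    (hcs : HasCompactSupport f) :
    ∃ M : ℝ, 0 ≤ M ∧ ∀ u, ∫ γ : RFib u, f γ.toArr ∂(haar.meas u) ≤ M := by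
  have hc := haar.continuous_integral_real hf hcs
  obtain ⟨M, hM⟩ := ((hcs.image (IsTopGroupoid.continuous_tgt (X := X))).image hc).bddAbove
  refine ⟨max M 0, le_max_right _ _, fun u => ?_⟩
  by_cases hu : u ∈ (fun γ : Arr X => γ.tgt) '' tsupport f
  · exact (hM (Set.mem_image_of_mem _ hu)).trans (le_max_left _ _)
  · have : ∀ γ : RFib u, f γ.toArr = 0 := fun γ =>
      image_eq_zero_of_notMem_tsupport fun h => hu ⟨γ.toArr, h, rfl⟩
    simp [this]

theorem continuous_arr_comp {Z : Type*} [TopologicalSpace Z] {a b c : Z → X}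
    {f : ∀ z, a z ⟶ b z} {g : ∀ z, b z ⟶ c z}
    (hf : Continuous (fun z => (⟨a z, b z, f z⟩ : Arr X)))
    (hg : Continuous (fun z => (⟨b z, c z, g z⟩ : Arr X))) :
    Continuous (fun z => (⟨a z, c z, f z ≫ g z⟩ : Arr X)) :=
  (IsTopGroupoid.continuous_comp (X := X)).comp
    (g := fun p : Comp X => (⟨p.a, p.c, p.fst ≫ p.snd⟩ : Arr X))
    (f := fun z => (⟨a z, b z, c z, f z, g z⟩ : Comp X))
    (continuous_induced_rng.2 (hg.prodMk hf))

theorem continuous_arr_inv {Z : Type*} [TopologicalSpace Z] {a b : Z → X} {f : ∀ z, a z ⟶ b z}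
    (hf : Continuous (fun z => (⟨a z, b z, f z⟩ : Arr X))) :
    Continuous (fun z => (⟨b z, a z, Groupoid.inv (f z)⟩ : Arr X)) :=
  (IsTopGroupoid.continuous_inv (X := X)).comp hf

/-- Inversion as a homeomorphism `G^u → G_u`. -/
def RFib.invHomeomorph (u : X) : RFib u ≃ₜ SFib u where
  toFun := RFib.inv
  invFun γ := ⟨γ.cod, Groupoid.inv γ.hom⟩
  left_inv γ := by simp [RFib.inv]
  right_inv γ := by simp [RFib.inv]
  continuous_toFun := SFib.continuous_mk (continuous_arr_inv (RFib.continuous_toArr u))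
  continuous_invFun := RFib.continuous_mk (continuous_arr_inv (SFib.continuous_toArr u))

/-- The homeomorphism `ζ ↦ γζ⁻¹` of `G_u` onto `G^{r(γ)}`, for `γ ∈ G_u`. -/
def SFib.mulInv {u : X} (γ : SFib u) : SFib u ≃ₜ RFib γ.cod where
  toFun ζ := ⟨ζ.cod, Groupoid.inv ζ.hom ≫ γ.hom⟩
  invFun η := ⟨η.dom, γ.hom ≫ Groupoid.inv η.hom⟩
  left_inv ζ := by simp
  right_inv η := by simp
  continuous_toFun := RFib.continuous_mk
    (continuous_arr_comp (continuous_arr_inv (SFib.continuous_toArr u)) continuous_const)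
  continuous_invFun := SFib.continuous_mk
    (continuous_arr_comp continuous_const (continuous_arr_inv (RFib.continuous_toArr γ.cod)))

/-- The homeomorphism `θ ↦ ηθ` of `G^{s(η)}` onto `G^{r(η)}`. -/
def RFib.mulLeft {u v : X} (η : u ⟶ v) : RFib u ≃ₜ RFib v where
  toFun θ := ⟨θ.dom, θ.hom ≫ η⟩
  invFun θ := ⟨θ.dom, θ.hom ≫ Groupoid.inv η⟩
  left_inv θ := by simp
  right_inv θ := by simp
  continuous_toFun := RFib.continuous_mk
    (continuous_arr_comp (RFib.continuous_toArr u) continuous_const)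
  continuous_invFun := RFib.continuous_mk
    (continuous_arr_comp (RFib.continuous_toArr v) continuous_const)

section Separation

variable [T2Space (Arr X)]

variable (X) in
theorem t2Space_unit : T2Space X :=
  T2Space.of_injective_continuous (f := fun u : X => (⟨u, u, 𝟙 u⟩ : Arr X))
    (fun _ _ h => congrArg Arr.src h) IsTopGroupoid.continuous_id

theorem RFib.isClosedEmbedding_toArr (u : X) : IsClosedEmbedding (RFib.toArr (u := u)) := by
  have := t2Space_unit X
  refine ⟨⟨⟨rfl⟩, fun γ η h => ?_⟩, ?_⟩
  · cases γ; cases η; cases h; rfl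
  · have : Set.range (RFib.toArr (u := u)) = (fun γ : Arr X => γ.tgt) ⁻¹' {u} := by
      ext ⟨a, b, f⟩
      constructor
      · rintro ⟨γ, hγ⟩
        exact (congrArg Arr.tgt hγ).symm
      · rintro (rfl : b = u)
        exact ⟨⟨a, f⟩, rfl⟩
    rw [this]
    exact isClosed_singleton.preimage IsTopGroupoid.continuous_tgt

instance RFib.t2Space (u : X) : T2Space (RFib u) :=
  (RFib.isClosedEmbedding_toArr u).isEmbedding.t2Space

theorem HaarSystem.integrable (haar : HaarSystem X) {E : Type*} [NormedAddCommGroup E] {u : X} {f : RFib u → E}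
    (hf : Continuous f) {K : Set (Arr X)} (hK : IsCompact K)
    (hfK : ∀ γ : RFib u, γ.toArr ∉ K → f γ = 0) : Integrable f (haar.meas u) := by
  have := haar.finite_on_compacts u
  exact hf.integrable_of_hasCompactSupport (HasCompactSupport.intro
    ((RFib.isClosedEmbedding_toArr u).isCompact_preimage hK) hfK)

variable [LocallyCompactSpace (Arr X)] [SecondCountableTopology (Arr X)]

instance RFib.secondCountable (u : X) : SecondCountableTopology (RFib u) :=
  (RFib.isClosedEmbedding_toArr u).isEmbedding.secondCountableTopology

instance RFib.locallyCompact (u : X) : LocallyCompactSpace (RFib u) :=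
  (RFib.isClosedEmbedding_toArr u).locallyCompactSpace

instance SFib.secondCountable (u : X) : SecondCountableTopology (SFib u) :=
  (RFib.invHomeomorph u).symm.secondCountableTopology

variable (haar : HaarSystem X)

instance HaarSystem.sigmaFinite_meas (u : X) : SigmaFinite (haar.meas u) :=
  have := haar.finite_on_compacts u
  inferInstance

instance HaarSystem.sigmaFinite_smeas (u : X) : SigmaFinite (haar.smeas u) :=
  (RFib.invHomeomorph u).toMeasurableEquiv.sigmaFinite_map

/-- Both measures are pushed forward to `G`, where left invariance gives equal integrals against all
of `C_c(G)`; this avoids extending test functions from the closed subset `G^v`. Riesz uniqueness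
applies on `G`, and the closed embedding brings the equality back to `G^v`. -/
theorem HaarSystem.map_mulLeft {u v : X} (η : u ⟶ v) :
    (haar.meas u).map (RFib.mulLeft η) = haar.meas v := by
  let _ : MeasurableSpace (Arr X) := borel _
  have : BorelSpace (Arr X) := ⟨rfl⟩
  have hu := haar.finite_on_compacts u
  have hv := haar.finite_on_compacts v
  have hemb := RFib.isClosedEmbedding_toArr v
  have hfin : ∀ μ : Measure (RFib v), IsFiniteMeasureOnCompacts μ →
      IsFiniteMeasureOnCompacts (μ.map RFib.toArr) := fun μ _ => ⟨fun K hK => by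
    rw [hemb.measurableEmbedding.map_apply]
    exact (hemb.isCompact_preimage hK).measure_lt_top⟩
  have h1 : IsFiniteMeasureOnCompacts ((haar.meas u).map (RFib.mulLeft η)) :=
    ⟨fun K hK => by
      rw [(RFib.mulLeft η).measurableEmbedding.map_apply]
      exact ((RFib.mulLeft η).isClosedEmbedding.isCompact_preimage hK).measure_lt_top⟩
  have hfin1 := hfin _ h1
  have hfin2 := hfin _ hv
  have key : ((haar.meas u).map (RFib.mulLeft η)).map RFib.toArr
      = (haar.meas v).map RFib.toArr := by
    refine Measure.ext_of_integral_eq_on_compactlySupported fun f => ?_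
    rw [hemb.measurableEmbedding.integral_map, hemb.measurableEmbedding.integral_map,
      (RFib.mulLeft η).measurableEmbedding.integral_map]
    have hf : Continuous fun γ => (f γ : ℂ) := Complex.continuous_ofReal.comp f.continuous
    have hcs : HasCompactSupport fun γ => (f γ : ℂ) :=
      f.hasCompactSupport.comp_left (g := fun x : ℝ => (x : ℂ)) (by simp)
    have := haar.left_invariant η (⟨⟨fun γ => (f γ : ℂ), hf⟩, hcs⟩ : Cc X)
    have h2 : ((∫ γ : RFib u, f ⟨γ.dom, v, γ.hom ≫ η⟩ ∂(haar.meas u) : ℝ) : ℂ)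
        = ((∫ γ : RFib v, f γ.toArr ∂(haar.meas v) : ℝ) : ℂ) := by
      rw [← integral_complex_ofReal, ← integral_complex_ofReal]
      exact this
    exact_mod_cast h2
  have hcomap := congrArg (Measure.comap (RFib.toArr (u := v))) key
  rwa [hemb.measurableEmbedding.comap_map, hemb.measurableEmbedding.comap_map] at hcomap

/-- With `ζ = θ⁻¹`, the map `ζ ↦ γζ⁻¹` becomes `θ ↦ γθ`, so this is left invariance. It turns every
integral over `G^{r(γ)}` into one over `G_u`. -/
theorem HaarSystem.measurePreserving_mulInv {u : X} (γ : SFib u) :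
    MeasurePreserving γ.mulInv (haar.smeas u) (haar.meas γ.cod) := by
  refine ⟨γ.mulInv.measurable, ?_⟩
  rw [HaarSystem.smeas, ← haar.map_mulLeft γ.hom,
    show (RFib.inv : RFib u → SFib u) = RFib.invHomeomorph u from rfl,
    Measure.map_map γ.mulInv.measurable (RFib.invHomeomorph u).measurable]
  congr 1
  ext1 θ
  simp [SFib.mulInv, RFib.mulLeft, RFib.invHomeomorph, RFib.inv]

/-- The indicator of `K` is dominated by a compactly supported bump function, whose integrals are
bounded uniformly in `u`. -/
theorem HaarSystem.exists_measure_le {K : Set (Arr X)} (hK : IsCompact K) :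
    ∃ M : ℝ≥0∞, M < ∞ ∧ ∀ u, haar.meas u (RFib.toArr ⁻¹' K) ≤ M := by
  obtain ⟨f, hf1, -, hcs, hf01⟩ := exists_continuous_one_zero_of_isCompact hK isClosed_empty
    (Set.disjoint_empty K)
  obtain ⟨M, -, hM⟩ := haar.exists_integral_le f.continuous hcs
  refine ⟨ENNReal.ofReal M, ENNReal.ofReal_lt_top, fun u => ?_⟩
  have hfc : Continuous fun γ : RFib u => f γ.toArr :=
    f.continuous.comp (RFib.continuous_toArr u)
  have hint : Integrable (fun γ : RFib u => f γ.toArr) (haar.meas u) :=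
    haar.integrable hfc hcs fun γ hγ => image_eq_zero_of_notMem_tsupport hγ
  have hKm : MeasurableSet (RFib.toArr (u := u) ⁻¹' K) :=
    (hK.isClosed.preimage (RFib.continuous_toArr u)).measurableSet
  calc haar.meas u (RFib.toArr ⁻¹' K)
      = ∫⁻ γ, (RFib.toArr ⁻¹' K).indicator 1 γ ∂(haar.meas u) := by
        rw [lintegral_indicator_one hKm]
    _ ≤ ∫⁻ γ : RFib u, ENNReal.ofReal (f γ.toArr) ∂(haar.meas u) := by
        refine lintegral_mono fun γ => ?_
        refine Set.indicator_le' (f := (1 : RFib u → ℝ≥0∞))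
          (g := fun γ : RFib u => ENNReal.ofReal (f γ.toArr)) (fun γ hγ => ?_)
          (fun _ _ => zero_le) γ
        simp [hf1 hγ]
    _ = ENNReal.ofReal (∫ γ : RFib u, f γ.toArr ∂(haar.meas u)) :=
        (ofReal_integral_eq_lintegral_ofReal hint
          (Eventually.of_forall fun γ => (hf01 γ.toArr).1)).symm
    _ ≤ ENNReal.ofReal M := ENNReal.ofReal_le_ofReal (hM u)

end Separation

end Grpd

end GpdProper

/-! ### Regular representations -/

namespace GpdProper

/-! ### The action and the involution on sections of `r^*𝒜` -/

section Action

variable {X : Type*} [Groupoid X] [TopologicalSpace (Arr X)]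
  {A : X → Type*} [∀ u, NonUnitalCStarAlgebra (A u)] [TopologicalSpace (Tot A)]

namespace DynSys

variable (S : DynSys X A)

theorem act_id {u : X} (x : A u) : S.act (𝟙 u) x = x :=
  EquivLike.injective (S.act (𝟙 u)) (by rw [S.act_comp, Category.comp_id])

theorem act_symm {u v : X} (γ : u ⟶ v) (x : A v) :
    (S.act γ).symm x = S.act (Groupoid.inv γ) x := by
  refine EquivLike.injective (S.act γ) ?_
  rw [S.act_comp, Groupoid.inv_comp, S.act_id]
  exact (S.act γ).apply_symm_apply x

theorem norm_act {u v : X} (γ : u ⟶ v) (x : A u) : ‖S.act γ x‖ = ‖x‖ :=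
  StarAlgEquiv.norm_map (S.act γ) x

theorem norm_act_symm {u v : X} (γ : u ⟶ v) (x : A v) : ‖(S.act γ).symm x‖ = ‖x‖ := by
  rw [act_symm, norm_act]

theorem continuous_act_apply {Z : Type*} [TopologicalSpace Z] {a b : Z → X} {γ : ∀ z, a z ⟶ b z}
    {x : ∀ z, A (a z)} (hγ : Continuous fun z => (⟨a z, b z, γ z⟩ : Arr X))
    (hx : Continuous fun z => (⟨a z, x z⟩ : Tot A)) :
    Continuous fun z => (⟨b z, S.act (γ z) (x z)⟩ : Tot A) :=
  S.continuous_act.comp (f := fun z => (⟨a z, b z, γ z, x z⟩ : ActDom A))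
    (continuous_induced_rng.2 (hγ.prodMk hx))

/-- The involution `f^*(γ) = α_γ(f(γ⁻¹)^*)` on sections of `r^*𝒜`. -/
def starSection (f : ∀ γ : Arr X, A γ.tgt) (γ : Arr X) : A γ.tgt :=
  S.act γ.hom (star (f γ.inv))

theorem norm_starSection (f : ∀ γ : Arr X, A γ.tgt) (γ : Arr X) :
    ‖S.starSection f γ‖ = ‖f γ.inv‖ := by
  rw [starSection, norm_act, norm_star]

theorem enorm_starSection (f : ∀ γ : Arr X, A γ.tgt) (γ : Arr X) :
    ‖S.starSection f γ‖ₑ = ‖f γ.inv‖ₑ := by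
  rw [← ofReal_norm, norm_starSection, ofReal_norm]

theorem starSection_starSection (f : ∀ γ : Arr X, A γ.tgt) :
    S.starSection (S.starSection f) = f := by
  ext γ
  obtain ⟨a, b, γ⟩ := γ
  simp only [starSection]
  rw [← map_star, star_star, S.act_comp]
  simp only [Groupoid.inv_comp, S.act_id]
  have : (⟨a, b, γ⟩ : Arr X).inv.inv = ⟨a, b, γ⟩ := by simp [Arr.inv]
  exact eq_of_heq (congr_arg_heq f this)

/-- This symmetry makes `algE` self-adjoint, so that a left ideal argument suffices. -/
theorem starSection_innerE (a b : ∀ u, A u) :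
    S.starSection (innerE S a b) = innerE S b a := by
  ext γ
  obtain ⟨u, v, γ⟩ := γ
  simp only [starSection, innerE, star_mul]
  rw [map_mul, ← map_star, star_star, S.act_comp]
  simp only [Groupoid.inv_comp, S.act_id]

theorem starSection_add (f g : ∀ γ : Arr X, A γ.tgt) :
    S.starSection (f + g) = S.starSection f + S.starSection g := by
  ext γ
  simp [starSection]

theorem starSection_smul (c : ℂ) (f : ∀ γ : Arr X, A γ.tgt) :
    S.starSection (c • f) = star c • S.starSection f := by
  ext γ
  simp [starSection, star_smul, map_smul]

/-- The pointwise form of the key convolution identity, with `k = φ(γζ⁻¹)` and `b` standing for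
`b(s(·))^*`. On the right the variable `ζ` survives only in `k` and `α_{γζ⁻¹}(a)`, so integrating
over `ζ` produces `φ · a`. `act_symm_mul_act` recognises the outcome as a kernel of an `innerE`
section. -/
theorem act_smul_mul_act {u v w x : X} (γ : u ⟶ v)
    (ζ : u ⟶ w) (θ : u ⟶ x) (k : ℂ) (c : A v) (a : A w) (b : A x) :
    (S.act γ).symm (k • c) * (S.act ζ).symm (a * S.act (Groupoid.inv θ ≫ ζ) b)
      = S.act (Groupoid.inv γ) (c * k • S.act (Groupoid.inv ζ ≫ γ) a)
        * S.act (Groupoid.inv θ) b := by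
  simp only [S.act_symm, map_mul, map_smul, S.act_comp, mul_smul_comm, smul_mul_assoc, mul_assoc]
  simp

theorem act_symm_mul_act {u v x : X} (γ : u ⟶ v) (θ : u ⟶ x) (a : A v) (b : A x) :
    (S.act γ).symm (a * S.act (Groupoid.inv θ ≫ γ) b)
      = S.act (Groupoid.inv γ) a * S.act (Groupoid.inv θ) b := by
  simp only [S.act_symm, map_mul, S.act_comp]
  simp

end DynSys

end Action

/-! ### The norm `‖·‖_I` and sections of finite norm -/

section Norms

variable {X : Type*} [Groupoid X] [TopologicalSpace X] [TopologicalSpace (Arr X)]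
  {A : X → Type*} [∀ u, NonUnitalCStarAlgebra (A u)]

/-- The range part `sup_u ∫ ‖f‖ dλ^u` of the norm `‖·‖_I`. -/
noncomputable def rNorm (haar : HaarSystem X) (f : ∀ γ : Arr X, A γ.tgt) : ℝ≥0∞ :=
  ⨆ u : X, ∫⁻ γ : RFib u, ‖f γ.toArr‖ₑ ∂(haar.meas u)

theorem rNorm_smul_le (haar : HaarSystem X) (c : ℂ) (f : ∀ γ : Arr X, A γ.tgt) :
    rNorm haar (c • f) ≤ ‖c‖ₑ * rNorm haar f := by
  refine iSup_le fun u => ?_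
  simp only [Pi.smul_apply, enorm_smul]
  rw [lintegral_const_mul' _ _ enorm_ne_top]
  gcongr
  exact le_iSup (fun u => ∫⁻ γ : RFib u, ‖f γ.toArr‖ₑ ∂(haar.meas u)) u

variable [TopologicalSpace (Tot A)]

variable (haar : HaarSystem X) (S : DynSys X A)

/-- The `α_γ` are isometric, so the second half of `‖f‖_I` is the range part for `f^*`. Statements
about `‖·‖_I` thereby reduce to `rNorm`, and the involution is isometric. -/
theorem iNorm_eq (f : ∀ γ : Arr X, A γ.tgt) :
    iNorm haar f = max (rNorm haar f) (rNorm haar (S.starSection f)) := by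
  simp only [iNorm, rNorm, S.enorm_starSection]

theorem iNorm_starSection (f : ∀ γ : Arr X, A γ.tgt) :
    iNorm haar (S.starSection f) = iNorm haar f := by
  rw [iNorm_eq haar S, iNorm_eq haar S, S.starSection_starSection, max_comm]

theorem iNorm_smul_le (S : DynSys X A) (c : ℂ) (f : ∀ γ : Arr X, A γ.tgt) :
    iNorm haar (c • f) ≤ ‖c‖ₑ * iNorm haar f := by
  simp only [iNorm_eq haar S, S.starSection_smul]
  refine max_le ((rNorm_smul_le haar c f).trans ?_) ((rNorm_smul_le haar _ _).trans ?_)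
  · gcongr; exact le_max_left _ _
  · rw [show ‖star c‖ₑ = ‖c‖ₑ by rw [← ofReal_norm, norm_star, ofReal_norm]]; gcongr; exact le_max_right _ _

/-- The section `f` of `r^*𝒜` is continuous and `‖f‖_I < ∞`. -/
structure IsL1Section (haar : HaarSystem X) (f : ∀ γ : Arr X, A γ.tgt) : Prop where
  continuous : Continuous (fun γ : Arr X => (⟨γ.tgt, f γ⟩ : Tot A))
  iNorm_lt_top : iNorm haar f < ∞

variable [IsUSCStarBundle A]

theorem continuous_section_fibre {f : ∀ γ : Arr X, A γ.tgt}
    (hf : Continuous (fun γ : Arr X => (⟨γ.tgt, f γ⟩ : Tot A))) (u : X) :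
    Continuous (Y := A u) (fun γ : RFib u => f γ.toArr) :=
  continuous_fibre (hf.comp (RFib.continuous_toArr u))

theorem continuous_section_add {f g : ∀ γ : Arr X, A γ.tgt}
    (hf : Continuous (fun γ : Arr X => (⟨γ.tgt, f γ⟩ : Tot A)))
    (hg : Continuous (fun γ : Arr X => (⟨γ.tgt, g γ⟩ : Tot A))) :
    Continuous (fun γ : Arr X => (⟨γ.tgt, (f + g) γ⟩ : Tot A)) :=
  continuous_iff_continuousAt.2 fun γ => tendsto_add (hf.tendsto γ) (hg.tendsto γ)

theorem continuous_section_smul {k : Arr X → ℂ} {f : ∀ γ : Arr X, A γ.tgt} (hk : Continuous k)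
    (hf : Continuous (fun γ : Arr X => (⟨γ.tgt, f γ⟩ : Tot A))) :
    Continuous (fun γ : Arr X => (⟨γ.tgt, k γ • f γ⟩ : Tot A)) :=
  continuous_iff_continuousAt.2 fun γ => tendsto_smul (hk.tendsto γ) (hf.tendsto γ)

theorem continuous_starSection [IsTopGroupoid X] {f : ∀ γ : Arr X, A γ.tgt}
    (hf : Continuous (fun γ : Arr X => (⟨γ.tgt, f γ⟩ : Tot A))) :
    Continuous (fun γ : Arr X => (⟨γ.tgt, S.starSection f γ⟩ : Tot A)) :=
  S.continuous_act_apply (continuous_id (X := Arr X))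
    (IsUSCStarBundle.continuous_star.comp (hf.comp IsTopGroupoid.continuous_inv))

theorem rNorm_add_le {f : ∀ γ : Arr X, A γ.tgt}
    (hf : Continuous (fun γ : Arr X => (⟨γ.tgt, f γ⟩ : Tot A))) (g : ∀ γ : Arr X, A γ.tgt) :
    rNorm haar (f + g) ≤ rNorm haar f + rNorm haar g := by
  refine iSup_le fun u => ?_
  calc ∫⁻ γ : RFib u, ‖(f + g) γ.toArr‖ₑ ∂(haar.meas u)
      ≤ ∫⁻ γ : RFib u, ‖f γ.toArr‖ₑ + ‖g γ.toArr‖ₑ ∂(haar.meas u) :=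
        lintegral_mono fun γ => enorm_add_le (f γ.toArr) (g γ.toArr)
    _ = _ := lintegral_add_left ((continuous_section_fibre hf u).enorm.measurable) _
    _ ≤ _ := add_le_add (le_iSup (fun u => ∫⁻ γ : RFib u, ‖f γ.toArr‖ₑ ∂(haar.meas u)) u)
      (le_iSup (fun u => ∫⁻ γ : RFib u, ‖g γ.toArr‖ₑ ∂(haar.meas u)) u)

theorem iNorm_add_le (S : DynSys X A) [IsTopGroupoid X] {f : ∀ γ : Arr X, A γ.tgt}
    (hf : Continuous (fun γ : Arr X => (⟨γ.tgt, f γ⟩ : Tot A))) (g : ∀ γ : Arr X, A γ.tgt) :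
    iNorm haar (f + g) ≤ iNorm haar f + iNorm haar g := by
  simp only [iNorm_eq haar S, S.starSection_add]
  exact max_le
    ((rNorm_add_le haar hf g).trans (add_le_add (le_max_left _ _) (le_max_left _ _)))
    ((rNorm_add_le haar (continuous_starSection S hf) _).trans
      (add_le_add (le_max_right _ _) (le_max_right _ _)))

variable {haar}

theorem IsL1Section.add [IsTopGroupoid X] {f g : ∀ γ : Arr X, A γ.tgt} (hf : IsL1Section haar f)
    (hg : IsL1Section haar g) (S : DynSys X A) : IsL1Section haar (f + g) :=
  ⟨continuous_section_add hf.continuous hg.continuous,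
    (iNorm_add_le haar S hf.continuous g).trans_lt
      (ENNReal.add_lt_top.2 ⟨hf.iNorm_lt_top, hg.iNorm_lt_top⟩)⟩

theorem IsL1Section.smul {f : ∀ γ : Arr X, A γ.tgt} (hf : IsL1Section haar f) (c : ℂ)
    (S : DynSys X A) : IsL1Section haar (c • f) :=
  ⟨continuous_section_smul continuous_const hf.continuous,
    (iNorm_smul_le haar S c f).trans_lt (ENNReal.mul_lt_top enorm_lt_top hf.iNorm_lt_top)⟩

theorem IsL1Section.star [IsTopGroupoid X] {f : ∀ γ : Arr X, A γ.tgt} (hf : IsL1Section haar f)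
    (S : DynSys X A) : IsL1Section haar (S.starSection f) :=
  ⟨continuous_starSection S hf.continuous, by
    rw [iNorm_starSection]; exact hf.iNorm_lt_top⟩

/-- The norm is only upper semicontinuous, which still gives local upper bounds; compactness of the
support makes them global. -/
theorem IsCcSection.exists_norm_le {f : ∀ γ : Arr X, A γ.tgt}
    (hf : IsCcSection f) : ∃ m : ℝ, 0 ≤ m ∧ ∀ γ, ‖f γ‖ ≤ m := by
  have hbdd : ∃ m : ℝ, ∀ γ ∈ closure {γ : Arr X | f γ ≠ 0}, ‖f γ‖ ≤ m := by
    refine hf.compact.induction_on (p := fun s => ∃ m : ℝ, ∀ γ ∈ s, ‖f γ‖ ≤ m) ⟨0, by simp⟩ ?_ ?_ ?_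
    · rintro s t hst ⟨m, hm⟩
      exact ⟨m, fun γ hγ => hm γ (hst hγ)⟩
    · rintro s t ⟨m, hm⟩ ⟨m', hm'⟩
      exact ⟨max m m', fun γ hγ => hγ.elim (fun h => (hm γ h).trans (le_max_left _ _))
        fun h => (hm' γ h).trans (le_max_right _ _)⟩
    · intro γ _
      exact ⟨_, mem_nhdsWithin_of_mem_nhds
        (eventually_norm_lt (hf.continuous.tendsto γ) (lt_add_one ‖f γ‖)),
        ‖f γ‖ + 1, fun η hη => le_of_lt hη⟩
  obtain ⟨m, hm⟩ := hbdd
  refine ⟨max m 0, le_max_right _ _, fun γ => ?_⟩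
  by_cases hγ : f γ = 0
  · simp [hγ]
  · exact (hm γ (subset_closure hγ)).trans (le_max_left _ _)

end Norms

/-! ### Compactly supported and integrable sections have finite `‖·‖_I` -/

section Compact

variable {X : Type*} [Groupoid X] [TopologicalSpace X] [TopologicalSpace (Arr X)]
  [IsTopGroupoid X] [T2Space (Arr X)] [LocallyCompactSpace (Arr X)]
  [SecondCountableTopology (Arr X)]
  {A : X → Type*} [∀ u, NonUnitalCStarAlgebra (A u)]
  (haar : HaarSystem X)

theorem exists_lintegral_le {K : Set (Arr X)} (hK : IsCompact K) :
    ∃ M : ℝ≥0∞, M < ∞ ∧ ∀ (m : ℝ) (u : X) (h : Arr X → ℝ≥0∞), (∀ γ, h γ ≤ ENNReal.ofReal m) →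
      (∀ γ, γ ∉ K → h γ = 0) →
      ∫⁻ γ : RFib u, h γ.toArr ∂(haar.meas u) ≤ ENNReal.ofReal m * M := by
  obtain ⟨M, hM, hMK⟩ := haar.exists_measure_le hK
  refine ⟨M, hM, fun m u h hm h0 => ?_⟩
  have hKm : MeasurableSet (RFib.toArr (u := u) ⁻¹' K) :=
    (hK.isClosed.preimage (RFib.continuous_toArr u)).measurableSet
  calc ∫⁻ γ : RFib u, h γ.toArr ∂(haar.meas u)
      ≤ ∫⁻ γ : RFib u, (RFib.toArr (u := u) ⁻¹' K).indicator
          (fun _ => ENNReal.ofReal m) γ ∂(haar.meas u) := by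
        refine lintegral_mono fun γ => ?_
        by_cases hγ : γ.toArr ∈ K
        · rw [Set.indicator_of_mem (by exact hγ)]; exact hm _
        · rw [h0 _ hγ]; exact zero_le
    _ = ENNReal.ofReal m * haar.meas u (RFib.toArr ⁻¹' K) := lintegral_indicator_const hKm _
    _ ≤ _ := by gcongr; exact hMK u

/-- On sections supported in a fixed compact set, `‖·‖_I` is dominated by the supremum norm. -/
theorem exists_iNorm_le {K : Set (Arr X)} (hK : IsCompact K) :
    ∃ M : ℝ≥0∞, M < ∞ ∧ ∀ (m : ℝ) (f : ∀ γ : Arr X, A γ.tgt), (∀ γ, ‖f γ‖ ≤ m) →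
      (∀ γ, γ ∉ K → f γ = 0) → iNorm haar f ≤ ENNReal.ofReal m * M := by
  obtain ⟨M₁, hM₁, h₁⟩ := exists_lintegral_le haar hK
  obtain ⟨M₂, hM₂, h₂⟩ := exists_lintegral_le haar
    (hK.image (IsTopGroupoid.continuous_inv (X := X)))
  refine ⟨max M₁ M₂, max_lt hM₁ hM₂, fun m f hm h0 => max_le (iSup_le fun u => ?_)
    (iSup_le fun u => ?_)⟩
  · refine (h₁ m u (fun γ => ‖f γ‖ₑ) (fun γ => ?_) fun γ hγ => ?_).trans
      (by gcongr; exact le_max_left _ _)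
    · rw [← ofReal_norm]; exact ENNReal.ofReal_le_ofReal (hm γ)
    · simp [h0 γ hγ]
  · refine (h₂ m u (fun γ => ‖f γ.inv‖ₑ) (fun γ => ?_) fun γ hγ => ?_).trans
      (by gcongr; exact le_max_right _ _)
    · rw [← ofReal_norm]; exact ENNReal.ofReal_le_ofReal (hm _)
    · rw [h0 γ.inv fun h => hγ ⟨γ.inv, h, by simp [Arr.inv]⟩, enorm_zero]

variable {haar} [TopologicalSpace (Tot A)]

theorem IsCcSection.isL1Section [IsUSCStarBundle A] {f : ∀ γ : Arr X, A γ.tgt}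
    (hf : IsCcSection f) : IsL1Section haar f := by
  obtain ⟨M, hM, hle⟩ := exists_iNorm_le (A := A) haar hf.compact
  obtain ⟨m, -, hm⟩ := hf.exists_norm_le
  refine ⟨hf.continuous, (hle m f hm fun γ hγ => ?_).trans_lt
    (ENNReal.mul_lt_top ENNReal.ofReal_lt_top hM)⟩
  by_contra h
  exact hγ (subset_closure h)

theorem IsIntegrableSection.isL1Section [IsUSCStarBundle A] (S : DynSys X A)
    {f : ∀ γ : Arr X, A γ.tgt} (hf : IsIntegrableSection haar f) : IsL1Section haar f := by
  obtain ⟨g, hg, hlt⟩ := hf.2 1 one_pos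
  refine ⟨hf.1, ?_⟩
  have hgL : IsL1Section haar g := hg.isL1Section
  have h := iNorm_add_le haar S hgL.continuous (fun γ => f γ - g γ)
  have he : g + (fun γ => f γ - g γ) = f := by ext γ; simp
  rw [he] at h
  exact h.trans_lt (ENNReal.add_lt_top.2 ⟨hgL.iNorm_lt_top, hlt.trans ENNReal.one_lt_top⟩)

end Compact

/-! ### The operators `Λ(f)` as direct sums of Schur kernels -/

section Regular

variable {X : Type*} [Groupoid X] [TopologicalSpace X] [TopologicalSpace (Arr X)]
  {A : X → Type*} [∀ u, NonUnitalCStarAlgebra (A u)] [TopologicalSpace (Tot A)]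
  {H : X → Type*} [∀ u, NormedAddCommGroup (H u)] [∀ u, InnerProductSpace ℂ (H u)]
  [∀ u, CompleteSpace (H u)]

variable {haar : HaarSystem X}

theorem IsRegularRep.unique {S : DynSys X A} {π : ∀ u, A u →⋆ₙₐ[ℂ] (H u →L[ℂ] H u)}
    {f : ∀ γ : Arr X, A γ.tgt} {T T' : RegAlg H haar} (h : IsRegularRep haar S π f T)
    (h' : IsRegularRep haar S π f T') : T = T' := by
  ext1 ξ
  refine lp.ext (funext fun u => Lp.ext ?_)
  exact (h ξ u).trans (h' ξ u).symm

variable [IsTopGroupoid X]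

/-- The kernel `k(γ, ζ) = π_u(α_γ⁻¹(f(γζ⁻¹)))` of `Ind π_u (f)`. -/
noncomputable def regKernel (S : DynSys X A) (π : ∀ u, A u →⋆ₙₐ[ℂ] (H u →L[ℂ] H u))
    (f : ∀ γ : Arr X, A γ.tgt) (u : X) (γ ζ : SFib u) : H u →L[ℂ] H u :=
  π u ((S.act γ.hom).symm (f (γ.mulInv ζ).toArr))

variable (S : DynSys X A) (π : ∀ u, A u →⋆ₙₐ[ℂ] (H u →L[ℂ] H u))
  {f g : ∀ γ : Arr X, A γ.tgt}

/-- Here `α_γ⁻¹ α_{γζ⁻¹} = α_ζ⁻¹` and `(γζ⁻¹)⁻¹ = ζγ⁻¹`. Thus the involution on sections matches the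
adjoint of integral kernels. -/
theorem regKernel_starSection (f : ∀ γ : Arr X, A γ.tgt) (u : X) (γ ζ : SFib u) :
    regKernel S π (S.starSection f) u γ ζ
      = ContinuousLinearMap.adjoint (regKernel S π f u ζ γ) := by
  rw [← ContinuousLinearMap.star_eq_adjoint]
  simp only [regKernel, ← map_star, S.act_symm, DynSys.starSection]
  rw [S.act_comp]
  have h1 : (γ.mulInv ζ).toArr.inv = (ζ.mulInv γ).toArr := by
    simp [Arr.inv, SFib.mulInv]
  have h2 : (γ.mulInv ζ).hom ≫ Groupoid.inv γ.hom = Groupoid.inv ζ.hom := by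
    simp [SFib.mulInv]
  have h3 : f (γ.mulInv ζ).toArr.inv = f (ζ.mulInv γ).toArr := eq_of_heq (congr_arg_heq f h1)
  rw [h3]
  exact congrArg (fun k : ζ.cod ⟶ u => π u (S.act k (star (f (ζ.mulInv γ).toArr)))) h2

theorem enorm_regKernel_le (f : ∀ γ : Arr X, A γ.tgt) (u : X) (γ ζ : SFib u) :
    ‖regKernel S π f u γ ζ‖ₑ ≤ ‖f (γ.mulInv ζ).toArr‖ₑ := by
  rw [← ofReal_norm, ← ofReal_norm, ← S.norm_act_symm γ.hom]
  exact ENNReal.ofReal_le_ofReal (NonUnitalStarAlgHom.norm_apply_le (π u) _)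

theorem continuous_regKernel [IsUSCStarBundle A]
    (hf : Continuous (fun γ : Arr X => (⟨γ.tgt, f γ⟩ : Tot A))) (u : X) :
    Continuous (Function.uncurry (regKernel S π f u)) := by
  have hπ : Continuous (π u) :=
    AddMonoidHomClass.continuous_of_bound (π u) 1 fun x => by
      rw [one_mul]; exact NonUnitalStarAlgHom.norm_apply_le (π u) x
  have h1 : Continuous fun p : SFib u × SFib u => (⟨u, p.1.cod, p.1.hom⟩ : Arr X) :=
    (SFib.continuous_toArr u).comp continuous_fst
  have h2 : Continuous fun p : SFib u × SFib u => (⟨u, p.2.cod, p.2.hom⟩ : Arr X) :=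
    (SFib.continuous_toArr u).comp continuous_snd
  have h3 : Continuous fun p : SFib u × SFib u => (p.1.mulInv p.2).toArr :=
    continuous_arr_comp (continuous_arr_inv h2) h1
  have h4 := S.continuous_act_apply (continuous_arr_inv h1) (hf.comp h3)
  refine hπ.comp (continuous_fibre (g := fun p : SFib u × SFib u =>
    (S.act p.1.hom).symm (f (p.1.mulInv p.2).toArr)) ?_)
  simpa only [S.act_symm] using h4

variable [T2Space (Arr X)] [LocallyCompactSpace (Arr X)] [SecondCountableTopology (Arr X)]

theorem integral_regKernel (f : ∀ γ : Arr X, A γ.tgt) {u : X} (ξ : SFib u → H u) (γ : SFib u) :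
    ∫ η : RFib γ.cod, π u ((S.act γ.hom).symm (f η.toArr))
        (ξ ⟨η.dom, γ.hom ≫ Groupoid.inv η.hom⟩) ∂(haar.meas γ.cod)
      = ∫ ζ, regKernel S π f u γ ζ (ξ ζ) ∂(haar.smeas u) := by
  rw [← (haar.measurePreserving_mulInv γ).integral_comp γ.mulInv.measurableEmbedding]
  refine integral_congr_ae (Eventually.of_forall fun ζ => ?_)
  exact congrArg (fun x => regKernel S π f u γ ζ (ξ x)) (γ.mulInv.symm_apply_apply ζ)

theorem isRegularRep_iff {T : RegAlg H haar} :
    IsRegularRep haar S π f T ↔ ∀ (ξ : RegSpace H haar) (u : X),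
      (T ξ u : SFib u → H u) =ᵐ[haar.smeas u]
        fun γ => ∫ ζ, regKernel S π f u γ ζ ((ξ u : SFib u → H u) ζ) ∂(haar.smeas u) := by
  simp only [IsRegularRep, integral_regKernel]

variable [IsUSCStarBundle A]

/-- Row integrals become integrals of `‖f‖` over `G^{r(γ)}`. Column integrals become integrals of
`‖f(η⁻¹)‖` over `G^{r(ζ)}`, since `γζ⁻¹ = (ζγ⁻¹)⁻¹`. These are the two halves of `‖f‖_I`. -/
theorem isKernel_regKernel (hf : IsL1Section haar f) (u : X) :
    Schur.IsKernel (haar.smeas u) (regKernel S π f u) (iNorm haar f) where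
  meas := (continuous_regKernel S π hf.continuous u).stronglyMeasurable
  lt_top := hf.iNorm_lt_top
  left γ := by
    refine (lintegral_mono fun ζ => enorm_regKernel_le S π f u γ ζ).trans ?_
    rw [(haar.measurePreserving_mulInv γ).lintegral_comp_emb γ.mulInv.measurableEmbedding
      (fun η : RFib γ.cod => ‖f η.toArr‖ₑ)]
    exact (le_iSup (fun v => ∫⁻ η : RFib v, ‖f η.toArr‖ₑ ∂(haar.meas v)) γ.cod).trans
      (le_max_left _ _)
  right ζ := by
    refine (lintegral_mono fun γ => enorm_regKernel_le S π f u γ ζ).trans ?_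
    have h : ∀ γ : SFib u, (γ.mulInv ζ).toArr = (ζ.mulInv γ).toArr.inv := fun γ => by
      simp [Arr.inv, SFib.mulInv]
    have h' : ∀ γ : SFib u, ‖f (γ.mulInv ζ).toArr‖ₑ = ‖f (ζ.mulInv γ).toArr.inv‖ₑ := fun γ =>
      congrArg (fun η : Arr X => ‖f η‖ₑ) (h γ)
    simp only [h']
    rw [(haar.measurePreserving_mulInv ζ).lintegral_comp_emb ζ.mulInv.measurableEmbedding
      (fun η : RFib ζ.cod => ‖f η.toArr.inv‖ₑ)]
    exact (le_iSup (fun v => ∫⁻ η : RFib v, ‖f η.toArr.inv‖ₑ ∂(haar.meas v)) ζ.cod).trans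
      (le_max_right _ _)

/-- The operator `Λ(f)`. -/
noncomputable def regRep (hf : IsL1Section haar f) : RegAlg H haar :=
  lp.mapCLM 2 (fun u => (isKernel_regKernel S π hf u).toCLM) (K := (iNorm haar f).toReal)
    ENNReal.toReal_nonneg fun u => (isKernel_regKernel S π hf u).norm_toCLM_le

theorem regRep_apply (hf : IsL1Section haar f) (ξ : RegSpace H haar) (u : X) :
    regRep S π hf ξ u = (isKernel_regKernel S π hf u).toCLM (ξ u) := rfl

theorem norm_regRep_le (hf : IsL1Section haar f) :
    ‖regRep S π hf‖ ≤ (iNorm haar f).toReal :=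
  lp.norm_mapCLM_le 2 _ _ _

theorem isRegularRep_regRep (hf : IsL1Section haar f) :
    IsRegularRep haar S π f (regRep S π hf) := fun ξ u => by
  rw [regRep_apply]
  filter_upwards [(isKernel_regKernel S π hf u).toCLM_ae (ξ u)] with γ hγ
  rw [hγ, integral_regKernel]

variable {S}

theorem existsUnique_isRegularRep (hf : IsL1Section haar f) :
    ∃! T : RegAlg H haar, IsRegularRep haar S π f T :=
  ⟨_, isRegularRep_regRep S π hf, fun _ h => h.unique (isRegularRep_regRep S π hf)⟩

theorem regRep_congr (hf : IsL1Section haar f) (hg : IsL1Section haar g) (h : f = g) :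
    regRep S π hf = regRep S π hg := by
  subst h; rfl

theorem regRep_add (hf : IsL1Section haar f) (hg : IsL1Section haar g) :
    regRep S π (hf.add hg S) = regRep S π hf + regRep S π hg := by
  refine (isRegularRep_regRep S π _).unique ((isRegularRep_iff S π).2 fun ξ u => ?_)
  rw [add_apply, lp.coeFn_add, Pi.add_apply]
  filter_upwards [Lp.coeFn_add (regRep S π hf ξ u) (regRep S π hg ξ u),
    (isKernel_regKernel S π hf u).toCLM_ae (ξ u), (isKernel_regKernel S π hg u).toCLM_ae (ξ u),
    (isKernel_regKernel S π hf u).ae_integrable (ξ u),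
    (isKernel_regKernel S π hg u).ae_integrable (ξ u)] with γ h1 h2 h3 h4 h5
  rw [h1, Pi.add_apply, regRep_apply, regRep_apply, h2, h3, ← integral_add h4 h5]
  refine integral_congr_ae (Eventually.of_forall fun ζ => ?_)
  simp [regKernel, map_add]

set_option synthInstance.maxHeartbeats 200000 in
theorem regRep_smul (c : ℂ) (hf : IsL1Section haar f) :
    regRep S π (hf.smul c S) = c • regRep S π hf := by
  refine (isRegularRep_regRep S π _).unique ((isRegularRep_iff S π).2 fun ξ u => ?_)
  rw [smul_apply, lp.coeFn_smul, Pi.smul_apply]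
  filter_upwards [Lp.coeFn_smul c (regRep S π hf ξ u),
    (isKernel_regKernel S π hf u).toCLM_ae (ξ u)] with γ h1 h2
  rw [h1, Pi.smul_apply, regRep_apply, h2, ← integral_smul]
  refine integral_congr_ae (Eventually.of_forall fun ζ => ?_)
  simp [regKernel, map_smul]

theorem star_regRep (hf : IsL1Section haar f) :
    star (regRep S π hf) = regRep S π (hf.star S) := by
  rw [ContinuousLinearMap.star_eq_adjoint, eq_comm, ContinuousLinearMap.eq_adjoint_iff]
  intro ξ η
  refine (lp.hasSum_inner _ _).unique ?_
  convert lp.hasSum_inner ξ (regRep S π hf η) using 2 with u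
  rw [regRep_apply, regRep_apply, ← inner_conj_symm, ← inner_conj_symm (ξ u),
    (isKernel_regKernel S π hf u).inner_toCLM]
  congr 2
  refine Lp.ext ?_
  filter_upwards [(isKernel_regKernel S π (hf.star S) u).toCLM_ae (ξ u),
    (isKernel_regKernel S π hf u).adjoint.toCLM_ae (ξ u)] with γ h1 h2
  rw [h1, h2]
  simp only [regKernel_starSection]

/-- Multiplicativity is phrased through kernels, so the convolution of two sections never has to be
shown to be a continuous section of finite norm; `h` is given in advance. -/
theorem regRep_mul {h : ∀ γ : Arr X, A γ.tgt} (hf : IsL1Section haar f) (hg : IsL1Section haar g)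
    (hh : IsL1Section haar h)
    (hint : ∀ u (γ θ : SFib u), Integrable
      (fun ζ => regKernel S π f u γ ζ * regKernel S π g u ζ θ) (haar.smeas u))
    (heq : ∀ u (γ θ : SFib u), regKernel S π h u γ θ
      = ∫ ζ, regKernel S π f u γ ζ * regKernel S π g u ζ θ ∂(haar.smeas u)) :
    regRep S π hf * regRep S π hg = regRep S π hh := by
  refine IsRegularRep.unique ((isRegularRep_iff S π).2 fun ξ u => ?_) (isRegularRep_regRep S π hh)
  exact (isKernel_regKernel S π hf u).toCLM_toCLM_ae (isKernel_regKernel S π hg u)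
    (hint u) (heq u) (ξ u)

end Regular

end GpdProper

/-! ### Sections obtained by integration along the range fibres -/

namespace GpdProper

/-- Indexing by points of `Y` lets data chosen at each point, such as a thin neighbourhood or an
approximating section, be attached to the partition function. -/
theorem exists_finite_partition {Y : Type*} [TopologicalSpace Y] [T2Space Y]
    [LocallyCompactSpace Y] {K O : Set Y} (hK : IsCompact K) (hO : IsOpen O) (hKO : K ⊆ O)
    {U : Y → Set Y} (hU : ∀ y, IsOpen (U y)) (hy : ∀ y, y ∈ U y) :
    ∃ (s : Finset Y) (φ : s → C(Y, ℝ)), (∀ i, tsupport (φ i) ⊆ U i ∩ O) ∧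
      (∀ i, HasCompactSupport (φ i)) ∧ (∀ i y, 0 ≤ φ i y) ∧ (∀ y, ∑ i, φ i y ≤ 1) ∧
      ∀ y ∈ K, ∑ i, φ i y = 1 := by
  obtain ⟨s, hs⟩ := hK.elim_nhds_subcover' (fun y _ => U y) fun y _ => (hU y).mem_nhds (hy y)
  classical
  let t : Finset Y := s.image Subtype.val
  have hcov : K ⊆ ⋃ i : t, U i ∩ O := fun y hyK => by
    obtain ⟨x, hxs, hxy⟩ := Set.mem_iUnion₂.1 (hs hyK)
    exact Set.mem_iUnion.2 ⟨⟨x, Finset.mem_image_of_mem _ hxs⟩, hxy, hKO hyK⟩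
  obtain ⟨φ, hsub, hcs⟩ := PartitionOfUnity.exists_isSubordinate_of_locallyFinite_t2space hK
    (fun i : t => U i ∩ O) (fun i => (hU i).inter hO) (locallyFinite_of_finite _) hcov
  refine ⟨t, φ, hsub, hcs, φ.nonneg, fun y => ?_, fun y hyK => ?_⟩
  · rw [← finsum_eq_sum_of_fintype]; exact φ.sum_le_one y
  · rw [← finsum_eq_sum_of_fintype]; exact φ.sum_eq_one hyK

section Integral

variable {X : Type*} [Groupoid X] [TopologicalSpace X] [TopologicalSpace (Arr X)]
  {A : X → Type*} [∀ u, NonUnitalCStarAlgebra (A u)] [TopologicalSpace (Tot A)]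
  [IsUSCStarBundle A]

theorem isCcSection_smul {f : ∀ γ : Arr X, A γ.tgt}
    (hf : Continuous (fun γ : Arr X => (⟨γ.tgt, f γ⟩ : Tot A)))
    {k : Arr X → ℂ} (hk : Continuous k) (hcs : HasCompactSupport k) :
    IsCcSection (fun γ => k γ • f γ) where
  continuous := continuous_section_smul hk hf
  compact := hcs.of_isClosed_subset isClosed_closure <| closure_mono fun γ hγ h => hγ (by simp [h])

variable [IsTopGroupoid X] [T2Space (Arr X)] (haar : HaarSystem X)
  {f : ∀ γ : Arr X, A γ.tgt}

theorem integrable_smul_section (hf : Continuous (fun γ : Arr X => (⟨γ.tgt, f γ⟩ : Tot A)))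
    {k : Arr X → ℂ} (hk : Continuous k) (hcs : HasCompactSupport k) (u : X) :
    Integrable (ε := A u) (fun γ : RFib u => k γ.toArr • f γ.toArr) (haar.meas u) :=
  haar.integrable (continuous_section_fibre (continuous_section_smul hk hf) u) hcs
    fun γ hγ => by
      have : k γ.toArr = 0 := image_eq_zero_of_notMem_tsupport hγ
      simp [this]

theorem norm_integral_smul_sub_le (hf : Continuous (fun γ : Arr X => (⟨γ.tgt, f γ⟩ : Tot A)))
    {φ : Arr X → ℝ} (hφ : Continuous φ) (hcs : HasCompactSupport φ) (h0 : ∀ γ, 0 ≤ φ γ)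
    {u : X} {y : A u} {δ : ℝ} (hδ : ∀ γ : RFib u, φ γ.toArr ≠ 0 → ‖f γ.toArr - y‖ ≤ δ) :
    ‖(∫ γ : RFib u, (φ γ.toArr : ℂ) • f γ.toArr ∂(haar.meas u) : A u)
        - ((∫ γ : RFib u, φ γ.toArr ∂(haar.meas u) : ℝ) : ℂ) • y‖
      ≤ δ * ∫ γ : RFib u, φ γ.toArr ∂(haar.meas u) := by
  have hk : Continuous fun γ => (φ γ : ℂ) := Complex.continuous_ofReal.comp hφ
  have hkcs : HasCompactSupport fun γ => (φ γ : ℂ) :=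
    hcs.comp_left (g := fun x : ℝ => (x : ℂ)) (by simp)
  have hi1 := integrable_smul_section haar hf hk hkcs u
  have hφi : Integrable (fun γ : RFib u => φ γ.toArr) (haar.meas u) :=
    haar.integrable (hφ.comp (RFib.continuous_toArr u)) hcs
      fun γ hγ => image_eq_zero_of_notMem_tsupport hγ
  have hi2 : Integrable (fun γ : RFib u => (φ γ.toArr : ℂ) • y) (haar.meas u) :=
    hφi.ofReal.smul_const y
  rw [← integral_complex_ofReal, ← integral_smul_const, ← integral_sub hi1 hi2,
    ← integral_const_mul]
  refine norm_integral_le_of_norm_le (hφi.const_mul δ) (Eventually.of_forall fun γ => ?_)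
  rw [← smul_sub, norm_smul, Complex.norm_real, Real.norm_of_nonneg (h0 _), mul_comm]
  by_cases hγ : φ γ.toArr = 0
  · simp [hγ]
  · exact mul_le_mul_of_nonneg_right (hδ γ hγ) (h0 _)

/-- On the support of `φ` all values of `f` lie in one thin set `W`. Over a fibre `u` near `v ∈
r(supp φ)`, the integral is therefore `m(u) y` up to `δ m(u)` for any `y ∈ W` over `u`, where `m` is
the continuous function `u ↦ ∫ φ dλ^u`. If `v ∉ r(supp φ)`, the integral vanishes near `v`. -/
theorem isApproxContAt_integral (hf : Continuous (fun γ : Arr X => (⟨γ.tgt, f γ⟩ : Tot A)))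
    {φ : Arr X → ℝ} (hφ : Continuous φ) (hcs : HasCompactSupport φ) (h0 : ∀ γ, 0 ≤ φ γ)
    {W : Set (Tot A)} (hW : IsOpen W) {δ : ℝ}
    (hthin : ∀ u, ∀ w w' : A u, (⟨u, w⟩ : Tot A) ∈ W → (⟨u, w'⟩ : Tot A) ∈ W → ‖w - w'‖ < δ)
    (hsub : ∀ γ ∈ tsupport φ, (⟨γ.tgt, f γ⟩ : Tot A) ∈ W) (v : X) :
    IsApproxContAt (fun u => (∫ γ : RFib u, (φ γ.toArr : ℂ) • f γ.toArr ∂(haar.meas u) : A u)) v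
      (fun u => δ * ∫ γ : RFib u, φ γ.toArr ∂(haar.meas u)) := by
  have := t2Space_unit X
  set m : X → ℝ := fun u => ∫ γ : RFib u, φ γ.toArr ∂(haar.meas u) with hm
  have hmc : Continuous m := haar.continuous_integral_real hφ hcs
  by_cases hv : v ∈ (fun γ : Arr X => γ.tgt) '' tsupport φ
  · obtain ⟨γ₀, hγ₀, rfl⟩ := hv
    refine ⟨(m γ₀.tgt : ℂ) • f γ₀, fun W' hW' => ?_⟩
    have htend : Tendsto (fun z : Tot A => (⟨z.base, (m z.base : ℂ) • z.val⟩ : Tot A))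
        (𝓝 (⟨γ₀.tgt, f γ₀⟩ : Tot A)) (𝓝 ⟨γ₀.tgt, (m γ₀.tgt : ℂ) • f γ₀⟩) := by
      refine tendsto_smul (x := fun z : Tot A => z.val) ?_ tendsto_id
      exact (Complex.continuous_ofReal.comp (hmc.comp
        (IsUSCStarBundle.continuous_proj (A := A)))).tendsto (⟨γ₀.tgt, f γ₀⟩ : Tot A)
    filter_upwards [eventually_exists_mem
      (inter_mem (htend hW') (hW.mem_nhds (hsub γ₀ hγ₀)))] with u ⟨y, hyW', hyW⟩
    refine ⟨(m u : ℂ) • y, hyW', norm_integral_smul_sub_le haar hf hφ hcs h0 fun γ hγ => ?_⟩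
    exact (hthin u _ _ (hsub γ.toArr (subset_tsupport _ hγ)) hyW).le
  · refine ⟨0, fun W' hW' => ?_⟩
    have hclosed : IsClosed ((fun γ : Arr X => γ.tgt) '' tsupport φ) :=
      (hcs.image IsTopGroupoid.continuous_tgt).isClosed
    filter_upwards [hclosed.isOpen_compl.mem_nhds hv,
      (continuous_zero_section (A := A)).tendsto v hW'] with u hu hu0
    have hz : ∀ γ : RFib u, φ γ.toArr = 0 := fun γ =>
      image_eq_zero_of_notMem_tsupport fun h => hu ⟨γ.toArr, h, rfl⟩
    exact ⟨0, hu0, by simp [hz]⟩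

variable [LocallyCompactSpace (Arr X)]

/-- A partition of unity cuts `f` into pieces with values in thin sets. Each piece has error
proportional to its mass, so the total error is controlled by the total mass and not by the number
of pieces. -/
theorem IsCcSection.continuous_integral (hf : IsCcSection f) :
    Continuous (fun u => (⟨u, ∫ γ : RFib u, f γ.toArr ∂(haar.meas u)⟩ : Tot A)) := by
  refine continuous_iff_continuousAt.2 fun v => continuousAt_of_isApproxContAt fun ε hε => ?_
  obtain ⟨K', hK', hKK'⟩ := exists_compact_superset hf.compact
  obtain ⟨χ, hχ1, -, hχcs, hχ01⟩ := exists_continuous_one_zero_of_isCompact hK' isClosed_empty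
    (Set.disjoint_empty K')
  obtain ⟨M, hM0, hM⟩ := haar.exists_integral_le χ.continuous hχcs
  -- `M` bounds the mass of the whole partition before the partition is chosen; adding `1` keeps the
  -- denominator positive when `M = 0`.
  have hδ : 0 < ε / (M + 1) := by positivity
  choose W hWo hzW hthin using fun γ : Arr X =>
    exists_isOpen_norm_sub_lt (⟨γ.tgt, f γ⟩ : Tot A) hδ
  obtain ⟨s, φ, hsub, hcs, h0, hle, hone⟩ := exists_finite_partition hf.compact isOpen_interior hKK'
    (U := fun γ => (fun η : Arr X => (⟨η.tgt, f η⟩ : Tot A)) ⁻¹' W γ)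
    (fun γ => (hWo γ).preimage hf.continuous) hzW
  have hsum := IsApproxContAt.sum Finset.univ fun i (_ : i ∈ Finset.univ) =>
    isApproxContAt_integral haar hf.continuous (φ i).continuous (hcs i) (h0 i) (hWo i) (hthin i)
      (fun γ hγ => (hsub i hγ).1) v
  have hci : ∀ i, Continuous fun γ => ((φ i γ : ℝ) : ℂ) := fun i =>
    Complex.continuous_ofReal.comp (φ i).continuous
  have hccs : ∀ i, HasCompactSupport fun γ => ((φ i γ : ℝ) : ℂ) := fun i =>
    (hcs i).comp_left (g := fun x : ℝ => (x : ℂ)) (by simp)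
  have heq : (fun u => (∫ γ : RFib u, f γ.toArr ∂(haar.meas u) : A u))
      = ∑ i, fun u => (∫ γ : RFib u, (φ i γ.toArr : ℂ) • f γ.toArr ∂(haar.meas u) : A u) := by
    ext u
    rw [Finset.sum_apply, ← integral_finsetSum _ fun i _ =>
      integrable_smul_section haar hf.continuous (hci i) (hccs i) u]
    refine integral_congr_ae (Eventually.of_forall fun γ => ?_)
    simp only
    rw [← Finset.sum_smul, ← Complex.ofReal_sum]
    by_cases hγ : f γ.toArr = 0
    · rw [hγ, smul_zero]
    · rw [hone γ.toArr (subset_closure hγ), Complex.ofReal_one, one_smul]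
  rw [← heq] at hsum
  refine hsum.mono (Eventually.of_forall fun u => ?_)
  have hφi : ∀ i, Integrable (fun γ : RFib u => φ i γ.toArr) (haar.meas u) := fun i =>
    haar.integrable ((φ i).continuous.comp (RFib.continuous_toArr u)) (hcs i)
      fun γ hγ => image_eq_zero_of_notMem_tsupport hγ
  have hχi : Integrable (fun γ : RFib u => χ γ.toArr) (haar.meas u) :=
    haar.integrable (χ.continuous.comp (RFib.continuous_toArr u)) hχcs
      fun γ hγ => image_eq_zero_of_notMem_tsupport hγ
  rw [Finset.sum_apply, ← Finset.mul_sum, ← integral_finsetSum _ fun i _ => hφi i]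
  -- `∑ φ_i ≤ χ`: on `K'` the function `χ` is `1`, and off `K'` every `φ_i` vanishes.
  have hbound : ∫ γ : RFib u, ∑ i, φ i γ.toArr ∂(haar.meas u) ≤ M := by
    refine (integral_mono (integrable_finsetSum _ fun i _ => hφi i) hχi fun γ => ?_).trans (hM u)
    by_cases hγ : γ.toArr ∈ K'
    · simpa [hχ1 hγ] using hle γ.toArr
    · have hz : ∀ i, φ i γ.toArr = 0 := fun i => image_eq_zero_of_notMem_tsupport fun h =>
        hγ (interior_subset (hsub i h).2)
      simpa [hz] using (hχ01 γ.toArr).1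
  calc ε / (M + 1) * ∫ γ : RFib u, ∑ i, φ i γ.toArr ∂(haar.meas u)
      ≤ ε / (M + 1) * (M + 1) := by gcongr; linarith
    _ = ε := by field_simp

theorem IsCcSection.isC0Section_integral (hf : IsCcSection f) :
    IsC0Section (fun u => (∫ γ : RFib u, f γ.toArr ∂(haar.meas u) : A u)) where
  continuous := hf.continuous_integral haar
  vanish ε hε := by
    have := t2Space_unit X
    -- Superlevel sets are closed by upper semicontinuity of the norm, and this one lies in the
    -- compact set `r(supp f)`.
    have hcl : IsClosed {u | ε ≤ ‖(∫ γ : RFib u, f γ.toArr ∂(haar.meas u) : A u)‖} := by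
      rw [← isOpen_compl_iff, isOpen_iff_mem_nhds]
      intro u hu
      filter_upwards [eventually_norm_lt ((hf.continuous_integral haar).tendsto u)
        (not_le.1 hu)] with v hv
      exact not_le.2 hv
    refine (hf.compact.image IsTopGroupoid.continuous_tgt).of_isClosed_subset hcl fun u hu => ?_
    by_contra hcon
    have hz : ∀ γ : RFib u, f γ.toArr = 0 := fun γ => by
      by_contra h
      exact hcon ⟨γ.toArr, subset_closure h, rfl⟩
    simp only [Set.mem_ofPred_eq, hz, integral_zero, norm_zero] at hu
    linarith

/-- Every value of `f ∈ Γ_c(G, r^*𝒜)` is approximated by values of sections in `Γ_0(X, 𝒜)`. -/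
theorem IsCcSection.exists_isC0Section (haar : HaarSystem X) (hf : IsCcSection f) (γ₀ : Arr X) {ε : ℝ} (hε : 0 < ε) :
    ∃ c : ∀ u, A u, IsC0Section c ∧ ‖c γ₀.tgt - f γ₀‖ ≤ ε := by
  obtain ⟨u₀, v₀, g₀⟩ := γ₀
  obtain ⟨W, hWo, hzW, hthin⟩ := exists_isOpen_norm_sub_lt (⟨v₀, f ⟨u₀, v₀, g₀⟩⟩ : Tot A) hε
  have hV := hWo.preimage hf.continuous
  obtain ⟨φ, hφ1, hφ0, hcs, h01⟩ := exists_continuous_one_zero_of_isCompact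
    (isCompact_singleton (x := (⟨u₀, v₀, g₀⟩ : Arr X))) hV.isClosed_compl
    (by simpa using hzW)
  have hfin := haar.finite_on_compacts v₀
  have hpos := haar.full_support v₀
  -- Full support of `λ^{v₀}` allows the bump to be normalised to mass `1` over `v₀`. The average of
  -- `f` against it then stays within `ε` of `f γ₀`.
  have hm : 0 < ∫ γ : RFib v₀, φ γ.toArr ∂(haar.meas v₀) := by
    refine Continuous.integral_pos_of_hasCompactSupport_nonneg_nonzero
      (φ.continuous.comp (RFib.continuous_toArr v₀))
      (hcs.comp_isClosedEmbedding (RFib.isClosedEmbedding_toArr v₀)) (fun γ => (h01 _).1)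
      (x := ⟨u₀, g₀⟩) ?_
    simp [hφ1 (Set.mem_singleton _)]
  set m := ∫ γ : RFib v₀, φ γ.toArr ∂(haar.meas v₀) with hmdef
  let ψ : Arr X → ℝ := fun γ => m⁻¹ * φ γ
  have hψ : Continuous ψ := continuous_const.mul φ.continuous
  have hψcs : HasCompactSupport ψ := hcs.mul_left
  have hψ1 : ∫ γ : RFib v₀, ψ γ.toArr ∂(haar.meas v₀) = 1 := by
    simp only [ψ]
    rw [integral_const_mul, ← hmdef, inv_mul_cancel₀ hm.ne']
  refine ⟨_, (isCcSection_smul hf.continuous (k := fun γ => (ψ γ : ℂ))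
    (Complex.continuous_ofReal.comp hψ)
    (hψcs.comp_left (g := fun x : ℝ => (x : ℂ)) (by simp))).isC0Section_integral haar, ?_⟩
  have h := norm_integral_smul_sub_le haar hf.continuous hψ hψcs
    (fun γ => mul_nonneg (inv_nonneg.2 hm.le) (h01 γ).1) (u := v₀) (y := f ⟨u₀, v₀, g₀⟩) (δ := ε)
    fun γ hγ => by
      refine (hthin v₀ _ _ ?_ hzW).le
      by_contra hcon
      exact hγ (by simp [ψ, show φ γ.toArr = 0 from hφ0 (x := γ.toArr) hcon])
  rwa [hψ1, Complex.ofReal_one, one_smul, mul_one] at h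

variable [SecondCountableTopology (Arr X)]

/-- The sections `γ ↦ ∑ φ_i(γ) c_i(r(γ))`, `φ_i ∈ C_c(G)`, `c_i` in a dense set of sections, are
dense in `Γ_c(G, r^*𝒜)` for `‖·‖_I`. -/
theorem IsCcSection.exists_sum_iNorm_lt (hf : IsCcSection f) {B : Set (∀ u, A u)}
    (hB : IsDenseInSections B) {ε : ℝ} (hε : 0 < ε) :
    ∃ (s : Finset (Arr X)) (c : s → ∀ u, A u) (φ : s → Cc X), (∀ i, c i ∈ B) ∧
      iNorm haar (f - ∑ i, fun γ => φ i γ • c i γ.tgt) < ENNReal.ofReal ε := by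
  obtain ⟨K', hK', hKK'⟩ := exists_compact_superset hf.compact
  obtain ⟨M, hM, hle⟩ := exists_iNorm_le (A := A) haar hK'
  -- All approximants will be supported in `K'`, so a uniform error `δ` costs at most `δ M` in
  -- `‖·‖_I`.
  obtain ⟨δ, hδ, hδM⟩ : ∃ δ : ℝ, 0 < δ ∧ ENNReal.ofReal δ * M < ENNReal.ofReal ε := by
    lift M to NNReal using hM.ne
    refine ⟨ε / (M + 1), by positivity, ?_⟩
    rw [← ENNReal.ofReal_coe_nnreal, ← ENNReal.ofReal_mul (by positivity)]
    refine (ENNReal.ofReal_lt_ofReal_iff hε).2 ?_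
    rw [div_mul_eq_mul_div, div_lt_iff₀ (by positivity)]
    nlinarith
  have hc : ∀ γ : Arr X, ∃ c ∈ B, ‖c γ.tgt - f γ‖ < δ := fun γ => by
    obtain ⟨c', hc', hc'f⟩ := IsCcSection.exists_isC0Section haar hf γ (ε := δ / 3) (by positivity)
    obtain ⟨c, hcB, hcc'⟩ := hB.2 c' hc' (δ / 3) (by positivity)
    refine ⟨c, hcB, ?_⟩
    calc ‖c γ.tgt - f γ‖ = ‖(c' γ.tgt - f γ) - (c' γ.tgt - c γ.tgt)‖ := by
          congr 1; abel
      _ ≤ ‖c' γ.tgt - f γ‖ + ‖c' γ.tgt - c γ.tgt‖ := norm_sub_le _ _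
      _ ≤ δ / 3 + δ / 3 := add_le_add hc'f (hcc' _)
      _ < δ := by linarith
  choose c hcB hcf using hc
  have hU : ∀ γ, IsOpen {η : Arr X | ‖c γ η.tgt - f η‖ < δ} := fun γ => by
    refine isOpen_iff_mem_nhds.2 fun η hη => ?_
    have hcc : Continuous fun η : Arr X => (⟨η.tgt, c γ η.tgt⟩ : Tot A) :=
      (hB.1 _ (hcB γ)).continuous.comp IsTopGroupoid.continuous_tgt
    exact eventually_norm_lt (tendsto_sub (hcc.tendsto η) (hf.continuous.tendsto η)) hη
  obtain ⟨s, φ, hsub, hcs, h0, hle1, hone⟩ := exists_finite_partition hf.compact isOpen_interior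
    hKK' hU hcf
  let ψ : s → Cc X := fun i => ⟨⟨fun γ => (φ i γ : ℂ), Complex.continuous_ofReal.comp
    (φ i).continuous⟩, (hcs i).comp_left (g := fun x : ℝ => (x : ℂ)) (by simp)⟩
  have hψ : ∀ i γ, ψ i γ = (φ i γ : ℂ) := fun i γ => rfl
  refine ⟨s, fun i => c i, ψ, fun i => hcB i, lt_of_le_of_lt (hle δ _ (fun γ => ?_) fun γ hγ => ?_)
    hδM⟩
  · have hexp : (f - ∑ i, fun γ => ψ i γ • c i γ.tgt) γ
        = ∑ i, (φ i γ : ℂ) • (f γ - c i γ.tgt) := by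
      rw [Pi.sub_apply, Finset.sum_apply]
      simp only [smul_sub, Finset.sum_sub_distrib, hψ]
      congr 1
      rw [← Finset.sum_smul, ← Complex.ofReal_sum]
      by_cases hγ : f γ = 0
      · rw [hγ, smul_zero]
      · rw [hone γ (subset_closure hγ), Complex.ofReal_one, one_smul]
    rw [hexp]
    calc ‖∑ i, (φ i γ : ℂ) • (f γ - c i γ.tgt)‖
        ≤ ∑ i, ‖(φ i γ : ℂ) • (f γ - c i γ.tgt)‖ := norm_sum_le _ _
      _ ≤ ∑ i, φ i γ * δ := by
          refine Finset.sum_le_sum fun i _ => ?_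
          rw [norm_smul, Complex.norm_real, Real.norm_of_nonneg (h0 i γ)]
          by_cases hz : φ i γ = 0
          · simp [hz]
          · rw [norm_sub_rev]
            exact mul_le_mul_of_nonneg_left (le_of_lt (hsub i (subset_tsupport _ hz)).1) (h0 i γ)
      _ = (∑ i, φ i γ) * δ := by rw [Finset.sum_mul]
      _ ≤ 1 * δ := by gcongr; exact hle1 γ
      _ = δ := one_mul δ
  · have hfz : f γ = 0 := by
      by_contra h
      exact hγ (interior_subset (hKK' (subset_closure h)))
    have hz : ∀ i, φ i γ = 0 := fun i => image_eq_zero_of_notMem_tsupport fun h =>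
      hγ (interior_subset (hsub i h).2)
    simp [hfz, hψ, hz]

end Integral

end GpdProper

/-! ### The ideal `E` -/

namespace GpdProper

/-- Left multiplication by generators is enough: the induction carries `x` and `star x` together,
which makes the star case trivial, and `y x = (x^* y^*)^*` turns left into right because `E` is
self-adjoint. -/
theorem mul_mem_of_mem_closure_adjoin {B : Type*} [CStarAlgebra B] {G : Set B}
    {E : Submodule ℂ B} (hE : IsClosed (E : Set B)) (hstar : ∀ y ∈ E, star y ∈ E)
    (hGstar : ∀ x ∈ G, star x ∈ G) (hG : ∀ x ∈ G, ∀ y ∈ E, x * y ∈ E) :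
    ∀ x ∈ (NonUnitalStarAlgebra.adjoin ℂ G).topologicalClosure, ∀ y ∈ E,
      x * y ∈ E ∧ y * x ∈ E := by
  have key : ∀ x ∈ NonUnitalStarAlgebra.adjoin ℂ G,
      (∀ y ∈ E, x * y ∈ E) ∧ ∀ y ∈ E, star x * y ∈ E := by
    intro x hx
    induction hx using NonUnitalStarAlgebra.adjoin_induction with
    | mem x hx => exact ⟨hG x hx, hG _ (hGstar x hx)⟩
    | add x x' _ _ h h' =>
      refine ⟨fun y hy => ?_, fun y hy => ?_⟩
      · rw [add_mul]; exact E.add_mem (h.1 y hy) (h'.1 y hy)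
      · rw [star_add, add_mul]; exact E.add_mem (h.2 y hy) (h'.2 y hy)
    | zero => simp
    | mul x x' _ _ h h' =>
      refine ⟨fun y hy => ?_, fun y hy => ?_⟩
      · rw [mul_assoc]; exact h.1 _ (h'.1 y hy)
      · rw [star_mul, mul_assoc]; exact h'.2 _ (h.2 y hy)
    | smul c x _ h =>
      refine ⟨fun y hy => ?_, fun y hy => ?_⟩
      · rw [smul_mul_assoc]; exact E.smul_mem _ (h.1 y hy)
      · rw [star_smul, smul_mul_assoc]; exact E.smul_mem _ (h.2 y hy)
    | star x _ h => exact ⟨h.2, by simpa using h.1⟩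
  intro x hx y hy
  have hx' : x ∈ closure (NonUnitalStarAlgebra.adjoin ℂ G : Set B) := hx
  refine ⟨?_, ?_⟩
  · have hcl : IsClosed {x : B | x * y ∈ E} := hE.preimage (continuous_mul_const y)
    exact closure_minimal (fun x hx => (key x hx).1 y hy) hcl hx'
  · have hcl : IsClosed {x : B | y * x ∈ E} := hE.preimage (continuous_const_mul y)
    refine closure_minimal (fun x hx => ?_) hcl hx'
    have := hstar _ ((key x hx).2 _ (hstar y hy))
    rwa [star_mul, star_star, star_star] at this

theorem mem_topologicalClosure_span_induction {B : Type*} [NormedAddCommGroup B]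
    [NormedSpace ℂ B] {G : Set B} {E : Submodule ℂ B} (hE : IsClosed (E : Set B))
    (φ : B →ₗ[ℂ] B) (hφ : Continuous φ) (hG : ∀ y ∈ G, φ y ∈ E) :
    ∀ y ∈ (Submodule.span ℂ G).topologicalClosure, φ y ∈ E := fun _ hy =>
  closure_minimal (t := φ ⁻¹' E)
    (show Submodule.span ℂ G ≤ E.comap φ from Submodule.span_le.2 hG) (hE.preimage hφ) hy

section Closed

variable {X : Type*} [Groupoid X] [TopologicalSpace X] [TopologicalSpace (Arr X)]
  {A : X → Type*} [∀ u, NonUnitalCStarAlgebra (A u)] [TopologicalSpace (Tot A)]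
  {H : X → Type*} [∀ u, NormedAddCommGroup (H u)] [∀ u, InnerProductSpace ℂ (H u)]
  [∀ u, CompleteSpace (H u)]

set_option synthInstance.maxHeartbeats 200000 in
theorem isClosed_algE (haar : HaarSystem X) (S : DynSys X A)
    (π : ∀ u, A u →⋆ₙₐ[ℂ] (H u →L[ℂ] H u)) (A₀ : NonUnitalStarSubalgebra ℂ (∀ u, A u)) : IsClosed ((algE haar S π A₀ : Submodule ℂ (RegAlg H haar)) : Set (RegAlg H haar)) :=
  Submodule.isClosed_topologicalClosure _

end Closed

/-! ### The convolution identity, self-adjointness of `E`, and `E ⊆ A ⋊_{α,r} G` -/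

section Ideal

variable {X : Type*} [Groupoid X] [TopologicalSpace X] [TopologicalSpace (Arr X)]
  [IsTopGroupoid X]
  {A : X → Type*} [∀ u, NonUnitalCStarAlgebra (A u)] [TopologicalSpace (Tot A)]
  [IsUSCStarBundle A] {haar : HaarSystem X} {S : DynSys X A}
  {H : X → Type*} [∀ u, NormedAddCommGroup (H u)] [∀ u, InnerProductSpace ℂ (H u)]
  [∀ u, CompleteSpace (H u)]

/-- The section `γ ↦ φ(γ) c(r(γ))` of `r^*𝒜`. -/
noncomputable def ccSection (φ : Cc X) (c : ∀ u, A u) (γ : Arr X) : A γ.tgt := φ γ • c γ.tgt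

theorem isCcSection_ccSection (φ : Cc X) {c : ∀ u, A u} (hc : IsC0Section c) :
    IsCcSection (ccSection φ c) :=
  isCcSection_smul (f := fun γ => c γ.tgt)
    (hc.continuous.comp (IsTopGroupoid.continuous_tgt (X := X))) φ.continuous φ.hasCompactSupport

theorem isCcSection_starSection [T2Space (Arr X)] {f : ∀ γ : Arr X, A γ.tgt} (hf : IsCcSection f) :
    IsCcSection (S.starSection f) where
  continuous := continuous_starSection S hf.continuous
  compact := by
    have hK := hf.compact.image (IsTopGroupoid.continuous_inv (X := X))
    refine hK.of_isClosed_subset isClosed_closure (closure_minimal (fun γ hγ => ?_) hK.isClosed)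
    refine ⟨γ.inv, subset_closure fun h => hγ ?_, by simp [Arr.inv]⟩
    simp only [DynSys.starSection]
    rw [h, star_zero, map_zero]

variable [T2Space (Arr X)] [LocallyCompactSpace (Arr X)] [SecondCountableTopology (Arr X)]
  (π : ∀ u, A u →⋆ₙₐ[ℂ] (H u →L[ℂ] H u))

theorem norm_regRep_sub_le {f g : ∀ γ : Arr X, A γ.tgt} (hf : IsL1Section haar f)
    (hg : IsL1Section haar g) :
    ‖regRep S π hf - regRep S π hg‖ ≤ (iNorm haar (f - g)).toReal := by
  have hd : f - g = f + (-1 : ℂ) • g := by rw [neg_one_smul, sub_eq_add_neg]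
  have h := hf.add (hg.smul (-1) S) S
  have he : regRep S π hf - regRep S π hg = regRep S π h := by
    rw [regRep_add π hf (hg.smul (-1) S), regRep_smul, neg_one_smul, sub_eq_add_neg]
  rw [he, hd]
  exact norm_regRep_le S π h

/-- The heart of the proof: `∫ φ(η) c(r(γ)) α_η(a(s(η))) α_γ(b(s(γ))^*) dλ^{r(γ)}(η)` equals `(c (φ
· a))(r(γ)) α_γ(b(s(γ))^*)`, since the factors `c(r(γ))` and `α_γ(b(s(γ))^*)` do not depend on `η`.
-/
theorem regRep_ccSection_mul_innerE {φ : Cc X} {c a b : ∀ u, A u}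
    (ha : IsC0Section a) (hf : IsL1Section haar (ccSection φ c))
    (hg : IsL1Section haar (innerE S a b))
    (hh : IsL1Section haar (innerE S (c * ccAct haar S φ a) b)) :
    regRep S π hf * regRep S π hg = regRep S π hh := by
  have hF0 : Continuous (fun γ : Arr X => (⟨γ.tgt, S.act γ.hom (a γ.src)⟩ : Tot A)) :=
    S.continuous_act_apply (continuous_id (X := Arr X))
      (ha.continuous.comp IsTopGroupoid.continuous_src)
  have hint0 : ∀ v, Integrable (fun η : RFib v => φ η.toArr • S.act η.hom (a η.dom))
      (haar.meas v) := fun v => integrable_smul_section haar hF0 φ.continuous φ.hasCompactSupport v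
  -- The factors independent of the integration variable are packed into one bounded linear map, so
  -- that the integral defining `φ · a` can be pulled through it.
  have hL : ∀ u (γ θ : SFib u), ∃ L : A γ.cod →L[ℂ] (H u →L[ℂ] H u), ∀ x,
      L x = π u (S.act (Groupoid.inv γ.hom) (c γ.cod * x)
        * S.act (Groupoid.inv θ.hom) (star (b θ.cod))) := fun u γ θ =>
    ⟨LinearMap.mkContinuous
      { toFun := fun x => π u (S.act (Groupoid.inv γ.hom) (c γ.cod * x)
          * S.act (Groupoid.inv θ.hom) (star (b θ.cod)))
        map_add' := fun x y => by simp only [mul_add, map_add, add_mul]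
        map_smul' := fun k x => by
          simp only [mul_smul_comm, map_smul, smul_mul_assoc, RingHom.id_apply] }
      (‖c γ.cod‖ * ‖b θ.cod‖) fun x => by
        simp only [LinearMap.coe_mk, AddHom.coe_mk]
        refine (NonUnitalStarAlgHom.norm_apply_le (π u) _).trans ((norm_mul_le _ _).trans ?_)
        rw [S.norm_act, S.norm_act, norm_star, mul_right_comm]
        exact mul_le_mul_of_nonneg_right (norm_mul_le _ _) (norm_nonneg _), fun x => rfl⟩
  choose L hL using hL
  have hprod : ∀ u (γ ζ θ : SFib u),
      regKernel S π (ccSection φ c) u γ ζ * regKernel S π (innerE S a b) u ζ θ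
        = L u γ θ (φ (γ.mulInv ζ).toArr •
            S.act (γ.mulInv ζ).hom (a (γ.mulInv ζ).dom)) := fun u γ ζ θ => by
    rw [hL]
    exact (map_mul (π u) _ _).symm.trans
      (congrArg (π u) (S.act_smul_mul_act γ.hom ζ.hom θ.hom _ _ _ _))
  have hcomp : ∀ u (γ θ : SFib u), Integrable (fun η : RFib γ.cod =>
      L u γ θ (φ η.toArr • S.act η.hom (a η.dom))) (haar.meas γ.cod) := fun u γ θ =>
    (L u γ θ).integrable_comp (hint0 γ.cod)
  refine regRep_mul π hf hg hh (fun u γ θ => ?_) fun u γ θ => ?_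
  · simp only [hprod]
    exact (haar.measurePreserving_mulInv γ).integrable_comp_of_integrable (hcomp u γ θ)
  · simp only [hprod]
    rw [(haar.measurePreserving_mulInv γ).integral_comp γ.mulInv.measurableEmbedding
      (fun η : RFib γ.cod => L u γ θ (φ η.toArr • S.act η.hom (a η.dom))),
      ContinuousLinearMap.integral_comp_comm _ (hint0 γ.cod), hL]
    exact congrArg (π u) (S.act_symm_mul_act γ.hom θ.hom _ _)

variable {A₀ : NonUnitalStarSubalgebra ℂ (∀ u, A u)}

theorem regRep_innerE_mem_algE {a b : ∀ u, A u} (ha : a ∈ A₀) (hb : b ∈ A₀)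
    (h : IsL1Section haar (innerE S a b)) : regRep S π h ∈ algE haar S π A₀ :=
  Submodule.le_topologicalClosure _
    (Submodule.subset_span ⟨a, ha, b, hb, isRegularRep_regRep S π h⟩)

theorem IsProper.isL1Section (hproper : IsProper haar S A₀) {a b : ∀ u, A u} (ha : a ∈ A₀) (hb : b ∈ A₀) :
    IsL1Section haar (innerE S a b) := (hproper.integrable a ha b hb).isL1Section S

theorem star_mem_algE (hproper : IsProper haar S A₀) :
    ∀ y ∈ algE haar S π A₀, star y ∈ algE haar S π A₀ := by
  intro y hy
  have hcl : IsClosed {y : RegAlg H haar | star y ∈ algE haar S π A₀} :=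
    (isClosed_algE haar S π A₀).preimage continuous_star
  refine closure_minimal (fun y hy => show star y ∈ algE haar S π A₀ from ?_) hcl hy
  induction hy using Submodule.span_induction with
  | mem y hy =>
    obtain ⟨a, ha, b, hb, hy⟩ := hy
    have hab := hproper.isL1Section ha hb
    have hba := hproper.isL1Section hb ha
    have : star y = regRep S π hba := by
      rw [hy.unique (isRegularRep_regRep S π hab), star_regRep]
      exact regRep_congr π _ _ (S.starSection_innerE a b)
    rw [this]
    exact regRep_innerE_mem_algE π hb ha hba
  | zero => simp
  | add x y _ _ hx hy =>
    rw [star_add]; exact add_mem hx hy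
  | smul c x _ hx =>
    rw [star_smul]; exact Submodule.smul_mem _ _ hx

/-- Integrability provides `g ∈ Γ_c(G, r^*𝒜)` close to `⟨a, b⟩_E` in `‖·‖_I`, and `Λ` is contractive
for that norm. -/
theorem algE_le_reducedCrossedProduct (hproper : IsProper haar S A₀) :
    ∀ y ∈ algE haar S π A₀, y ∈ reducedCrossedProduct haar S π := by
  intro y hy
  have hcl : IsClosed (reducedCrossedProduct haar S π : Set (RegAlg H haar)) :=
    NonUnitalStarSubalgebra.isClosed_topologicalClosure _
  refine closure_minimal (fun y hy => ?_) hcl hy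
  induction hy using Submodule.span_induction with
  | mem y hy =>
    obtain ⟨a, ha, b, hb, hy⟩ := hy
    have hab := hproper.isL1Section ha hb
    rw [hy.unique (isRegularRep_regRep S π hab)]
    refine Metric.mem_closure_iff.2 fun ε hε => ?_
    obtain ⟨g, hg, hlt⟩ := (hproper.integrable a ha b hb).2 (ENNReal.ofReal ε) (by simpa using hε)
    have hgL : IsL1Section haar g := hg.isL1Section
    refine ⟨regRep S π hgL, NonUnitalStarAlgebra.subset_adjoin ℂ _
      ⟨g, hg, isRegularRep_regRep S π hgL⟩, ?_⟩
    rw [dist_eq_norm]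
    refine (norm_regRep_sub_le π hab hgL).trans_lt ?_
    exact (ENNReal.lt_ofReal_iff_toReal_lt (hlt.trans ENNReal.ofReal_lt_top).ne).1 hlt
  | zero => exact zero_mem (reducedCrossedProduct haar S π)
  | add x y _ _ hx hy => exact add_mem (S := NonUnitalStarSubalgebra ℂ (RegAlg H haar)) hx hy
  | smul c x _ hx => exact SMulMemClass.smul_mem c hx

end Ideal

/-! ### From `C ⊗ A₀` to all of `Γ_c(G, r^*𝒜)` by density -/

section Density

variable {X : Type*} [Groupoid X] [TopologicalSpace X] [TopologicalSpace (Arr X)]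
  [IsTopGroupoid X] [T2Space (Arr X)] [LocallyCompactSpace (Arr X)]
  [SecondCountableTopology (Arr X)]
  {A : X → Type*} [∀ u, NonUnitalCStarAlgebra (A u)] [TopologicalSpace (Tot A)]
  [IsUSCStarBundle A] {haar : HaarSystem X} {S : DynSys X A}
  {H : X → Type*} [∀ u, NormedAddCommGroup (H u)] [∀ u, InnerProductSpace ℂ (H u)]
  [∀ u, CompleteSpace (H u)] (π : ∀ u, A u →⋆ₙₐ[ℂ] (H u →L[ℂ] H u))

theorem isL1Section_ccSection (haar : HaarSystem X) (φ : Cc X) {c : ∀ u, A u}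
    (hc : IsC0Section c) : IsL1Section haar (ccSection φ c) :=
  (isCcSection_ccSection φ hc).isL1Section

variable (haar S) in
set_option synthInstance.maxHeartbeats 200000 in
/-- The linear map `φ ↦ Λ(φ ⊗ c)` on `C_c(G)`. -/
noncomputable def ccRep {c : ∀ u, A u} (hc : IsC0Section c) : Cc X →ₗ[ℂ] RegAlg H haar where
  toFun φ := regRep S π (isL1Section_ccSection haar φ hc)
  map_add' φ ψ := by
    rw [← regRep_add]
    exact regRep_congr π _ _ (funext fun γ => add_smul (φ γ) (ψ γ) (c γ.tgt))
  map_smul' k φ := by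
    rw [RingHom.id_apply, ← regRep_smul]
    exact regRep_congr π _ _ (funext fun γ => smul_assoc k (φ γ) (c γ.tgt))

/-- This makes `φ ↦ ‖Λ(φ ⊗ c)‖` one of the seminorms defining the inductive limit topology. -/
theorem ccRep_bound {c : ∀ u, A u} (hc : IsC0Section c) {K : Set (Arr X)} (hK : IsCompact K) :
    ∃ M : ℝ, ∀ φ : Cc X, tsupport φ ⊆ K → ∀ m : ℝ, (∀ γ, ‖φ γ‖ ≤ m) →
      ‖ccRep haar S π hc φ‖ ≤ M * m := by
  -- For empty `G` the bound `m` could be negative; a point of `G` forces `0 ≤ m`.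
  rcases isEmpty_or_nonempty (Arr X) with hemp | ⟨⟨γ₀⟩⟩
  · refine ⟨0, fun φ _ m _ => ?_⟩
    have : φ = 0 := by ext γ; exact isEmptyElim γ
    simp [this]
  obtain ⟨χ, hχ1, -, hχcs, -⟩ := exists_continuous_one_zero_of_isCompact hK isClosed_empty
    (Set.disjoint_empty K)
  -- As `χ = 1` on `K`, a bound for `χ ⊗ c` bounds `‖c(r(γ))‖` for `γ ∈ K`.
  obtain ⟨B, hB0, hB⟩ := (isCcSection_ccSection (⟨⟨fun γ => (χ γ : ℂ),
    Complex.continuous_ofReal.comp χ.continuous⟩,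
    hχcs.comp_left (g := fun x : ℝ => (x : ℂ)) (by simp)⟩ : Cc X) hc).exists_norm_le
  obtain ⟨M, hM, hle⟩ := exists_iNorm_le (A := A) haar hK
  refine ⟨B * M.toReal, fun φ hφ m hm => ?_⟩
  have hm0 : 0 ≤ m := (norm_nonneg _).trans (hm γ₀)
  have hz : ∀ γ, γ ∉ K → φ γ = 0 := fun γ hγ =>
    image_eq_zero_of_notMem_tsupport fun h => hγ (hφ h)
  have h := hle (m * B) (ccSection φ c) (fun γ => ?_) fun γ hγ => by simp [ccSection, hz γ hγ]
  · refine (norm_regRep_le S π (isL1Section_ccSection haar φ hc)).trans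
      ((ENNReal.toReal_mono (ENNReal.mul_lt_top ENNReal.ofReal_lt_top hM).ne h).trans_eq ?_)
    rw [ENNReal.toReal_mul, ENNReal.toReal_ofReal (mul_nonneg hm0 hB0)]
    ring
  · by_cases hγ : γ ∈ K
    · have hBγ : ‖((χ γ : ℝ) : ℂ) • c γ.tgt‖ ≤ B := hB γ
      rw [hχ1 hγ] at hBγ
      simp only [Pi.one_apply, Complex.ofReal_one, one_smul] at hBγ
      rw [ccSection, norm_smul]
      exact mul_le_mul (hm γ) hBγ (norm_nonneg _) hm0
    · simp only [ccSection, hz γ hγ, zero_smul, norm_zero]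
      positivity

theorem exists_regRep_mem_of_sum {V : Submodule ℂ (RegAlg H haar)} {ι : Type*} (s : Finset ι)
    (c : ι → ∀ u, A u) (φ : ι → Cc X) (hc : ∀ i, IsC0Section (c i))
    (hV : ∀ i, ccRep haar S π (hc i) (φ i) ∈ V) :
    ∃ h : IsL1Section haar (∑ i ∈ s, fun γ => φ i γ • c i γ.tgt), regRep S π h ∈ V := by
  classical
  induction s using Finset.induction_on with
  | empty =>
    have h0 : iNorm haar (0 : ∀ γ : Arr X, A γ.tgt) = 0 := by simp [iNorm]
    have h : IsL1Section haar (0 : ∀ γ : Arr X, A γ.tgt) :=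
      ⟨(continuous_zero_section (A := A)).comp IsTopGroupoid.continuous_tgt, by simp [h0]⟩
    refine ⟨h, ?_⟩
    have hz : regRep S π h = 0 := by
      have := norm_regRep_le S π h
      rw [h0, ENNReal.toReal_zero] at this
      exact norm_le_zero_iff.1 this
    change regRep S π h ∈ V
    rw [hz]
    exact V.zero_mem
  | insert i s hi ih =>
    obtain ⟨h, hm⟩ := ih
    rw [Finset.sum_insert hi]
    refine ⟨(isL1Section_ccSection haar (φ i) (hc i)).add h S, ?_⟩
    have := V.add_mem (hV i) hm
    rwa [ccRep, LinearMap.coe_mk, AddHom.coe_mk, ← regRep_add] at this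

variable {A₀ : NonUnitalStarSubalgebra ℂ (∀ u, A u)} {C : Submodule ℂ (Cc X)}

/-- The convolution identity sends `⟨a, b⟩_E` to `⟨c (φ · a), b⟩_E`, and `c (φ · a) ∈ A₀` because `C
· A₀ ⊆ A₀` and `A₀` is an algebra. -/
theorem ccRep_mul_mem_algE_of_mem (hproper : IsProper haar S A₀)
    (hCA : ∀ f ∈ C, ∀ a ∈ A₀, ccAct haar S f a ∈ A₀) {c : ∀ u, A u} (hcA : c ∈ A₀)
    {φ : Cc X} (hφ : φ ∈ C) :
    ∀ y ∈ algE haar S π A₀,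
      ccRep haar S π (hproper.dense.1 c hcA) φ * y ∈ algE haar S π A₀ := by
  refine mem_topologicalClosure_span_induction (isClosed_algE haar S π A₀)
    (LinearMap.mulLeft ℂ (ccRep haar S π (hproper.dense.1 c hcA) φ))
    (continuous_const_mul _) ?_
  rintro y ⟨a, ha, b, hb, hy⟩
  have hab := hproper.isL1Section ha hb
  have hca := mul_mem hcA (hCA φ hφ a ha)
  rw [hy.unique (isRegularRep_regRep S π hab), LinearMap.mulLeft_apply]
  have := regRep_ccSection_mul_innerE π (hproper.dense.1 a ha)
    (isL1Section_ccSection haar φ (hproper.dense.1 c hcA)) hab (hproper.isL1Section hca hb)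
  exact this ▸ regRep_innerE_mem_algE π hca hb (hproper.isL1Section hca hb)

/-- The operators that multiply `E` into itself from the left. -/
def leftMultipliers {B : Type*} [CStarAlgebra B] (E : Submodule ℂ B) : Submodule ℂ B where
  carrier := {x | ∀ y ∈ E, x * y ∈ E}
  add_mem' := fun hx hx' y hy => by rw [add_mul]; exact E.add_mem (hx y hy) (hx' y hy)
  zero_mem' := fun y _ => by rw [zero_mul]; exact E.zero_mem
  smul_mem' := fun k x hx y hy => by rw [smul_mul_assoc]; exact E.smul_mem k (hx y hy)

theorem isClosed_leftMultipliers {B : Type*} [CStarAlgebra B] {E : Submodule ℂ B}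
    (hE : IsClosed (E : Set B)) : IsClosed (leftMultipliers E : Set B) := by
  have : (leftMultipliers E : Set B) = ⋂ y ∈ E, (fun x => x * y) ⁻¹' (E : Set B) := by
    ext x; simp [leftMultipliers]
  rw [this]
  exact isClosed_biInter fun y _ => hE.preimage (continuous_mul_const y)

/-- Inductive limit density of `C`, tested on the single seminorm `φ ↦ ‖Λ(φ ⊗ c)‖`, together with
closedness of the left multipliers. -/
theorem ccRep_mem_leftMultipliers (hproper : IsProper haar S A₀) (hdense : IsIndLimDense C)
    (hCA : ∀ f ∈ C, ∀ a ∈ A₀, ccAct haar S f a ∈ A₀) {c : ∀ u, A u} (hcA : c ∈ A₀) (φ : Cc X) :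
    ccRep haar S π (hproper.dense.1 c hcA) φ ∈ leftMultipliers (algE haar S π A₀) := by
  refine (isClosed_leftMultipliers (isClosed_algE haar S π A₀)).closure_subset
    (Metric.mem_closure_iff.2 fun ε hε => ?_)
  obtain ⟨ψ, hψ, hlt⟩ := hdense
    ((normSeminorm ℂ (RegAlg H haar)).comp (ccRep haar S π (hproper.dense.1 c hcA)))
    (fun K hK => ccRep_bound π (hproper.dense.1 c hcA) hK) φ ε hε
  refine ⟨_, ccRep_mul_mem_algE_of_mem π hproper hCA hcA hψ, ?_⟩
  rw [dist_eq_norm, ← map_sub]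
  exact hlt

theorem regRep_mem_leftMultipliers (hproper : IsProper haar S A₀) (hdense : IsIndLimDense C)
    (hCA : ∀ f ∈ C, ∀ a ∈ A₀, ccAct haar S f a ∈ A₀) {f : ∀ γ : Arr X, A γ.tgt}
    (hf : IsCcSection f) (hfL : IsL1Section haar f) :
    regRep S π hfL ∈ leftMultipliers (algE haar S π A₀) := by
  refine (isClosed_leftMultipliers (isClosed_algE haar S π A₀)).closure_subset
    (Metric.mem_closure_iff.2 fun ε hε => ?_)
  obtain ⟨s, c, φ, hc, hlt⟩ := hf.exists_sum_iNorm_lt haar hproper.dense hε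
  obtain ⟨hL, hmem⟩ := exists_regRep_mem_of_sum (S := S) π Finset.univ c φ
    (fun i => hproper.dense.1 _ (hc i))
    fun i => ccRep_mem_leftMultipliers π hproper hdense hCA (hc i) (φ i)
  refine ⟨_, hmem, ?_⟩
  rw [dist_eq_norm]
  refine (norm_regRep_sub_le π hfL hL).trans_lt ?_
  exact (ENNReal.lt_ofReal_iff_toReal_lt (hlt.trans ENNReal.ofReal_lt_top).ne).1 hlt

end Density

end GpdProper

theorem propositionA1 {X : Type*} [Groupoid X] [TopologicalSpace X]
    [TopologicalSpace (GpdProper.Arr X)] [GpdProper.IsTopGroupoid X]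
    [T2Space (GpdProper.Arr X)] [LocallyCompactSpace (GpdProper.Arr X)]
    [SecondCountableTopology (GpdProper.Arr X)]
    (haar : GpdProper.HaarSystem X)
    {A : X → Type*} [∀ u, NonUnitalCStarAlgebra (A u)] [TopologicalSpace (GpdProper.Tot A)]
    [GpdProper.IsUSCStarBundle A] (hsep : GpdProper.IsSeparableSections A)
    (S : GpdProper.DynSys X A)
    (A₀ : NonUnitalStarSubalgebra ℂ (∀ u, A u)) (hproper : GpdProper.IsProper haar S A₀)
    (C : Submodule ℂ (GpdProper.Cc X)) (hC : GpdProper.IsStarSubalgebraCc haar C)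
    (hdense : GpdProper.IsIndLimDense C)
    (hCA : ∀ f ∈ C, ∀ a ∈ A₀, GpdProper.ccAct haar S f a ∈ A₀)
    {H : X → Type*} [∀ u, NormedAddCommGroup (H u)] [∀ u, InnerProductSpace ℂ (H u)]
    [∀ u, CompleteSpace (H u)]
    (π : ∀ u, A u →⋆ₙₐ[ℂ] (H u →L[ℂ] H u)) (hπ : ∀ u, Function.Injective (π u)) :
    (∀ f : ∀ γ : GpdProper.Arr X, A γ.tgt, GpdProper.IsCcSection f →
      ∃! T : GpdProper.RegAlg H haar, GpdProper.IsRegularRep haar S π f T) ∧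
    (∀ a ∈ A₀, ∀ b ∈ A₀,
      ∃! T : GpdProper.RegAlg H haar,
        GpdProper.IsRegularRep haar S π (GpdProper.innerE S a b) T) ∧
    (∀ y ∈ GpdProper.algE haar S π A₀, y ∈ GpdProper.reducedCrossedProduct haar S π) ∧
    (∀ x ∈ GpdProper.reducedCrossedProduct haar S π, ∀ y ∈ GpdProper.algE haar S π A₀,
      x * y ∈ GpdProper.algE haar S π A₀ ∧ y * x ∈ GpdProper.algE haar S π A₀) := by
  refine ⟨fun f hf => GpdProper.existsUnique_isRegularRep π hf.isL1Section, fun a ha b hb =>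
    GpdProper.existsUnique_isRegularRep π (hproper.isL1Section ha hb),
    GpdProper.algE_le_reducedCrossedProduct π hproper,
    GpdProper.mul_mem_of_mem_closure_adjoin (GpdProper.isClosed_algE haar S π A₀)
      (GpdProper.star_mem_algE π hproper) ?_ ?_⟩
  -- The generating operators are closed under adjoints: `Λ(f)^* = Λ(f^*)`, with `f^*` again
  -- compactly supported.
  · rintro T ⟨f, hf, hT⟩
    rw [hT.unique (GpdProper.isRegularRep_regRep S π hf.isL1Section), GpdProper.star_regRep]
    exact ⟨_, GpdProper.isCcSection_starSection hf, GpdProper.isRegularRep_regRep S π _⟩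
  · rintro T ⟨f, hf, hT⟩
    rw [hT.unique (GpdProper.isRegularRep_regRep S π hf.isL1Section)]
    exact GpdProper.regRep_mem_leftMultipliers π hproper hdense hCA hf _
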